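/- Let $A=\bigoplus_{i\ge 0}A_i$ be a Noetherian commutative $\mathbb{N}$-graded ring with identity. Let $\varepsilon\colon A\to A[X]$ be the ring homomorphism $b_0+b_1+b_2+\cdots\mapsto b_0+b_1X+b_2X^2+\cdots$ (with $b_i\in A_i$), and for $a\in A_0$ put $b^+(a)=\varepsilon(b)(a)\in A$; for a matrix $\alpha$ over $A$ let $\alpha^+(a)$ be obtained by applying $b\mapsto b^+(a)$ to all entries (so $\alpha^+(0)$ is the matrix of degree-zero components). For a prime ideal $\mathfrak p$ of $A_0$ let $A_{\mathfrak p}$ be the localization of $A$ at the multiplicative set $A_0\setminus\mathfrak p$, and let $\alpha_{\mathfrak p}$ be the image of $\alpha$ over $A_{\mathfrak p}$. For a group $G$ let $[G,G]$ be its commutator subgroup, i.e. the subgroup generated by all $ghg^{-1}h^{-1}$ with $g,h\in G$. For a commutative ring $R$ let $\mathrm S(n,R)$ denote either $\mathrm{SL}_n(R)$ with $n\ge 3$, or the symplectic group $\mathrm{Sp}_{n}(R)$, $n=2m\ge 6$, of the standard alternating form on $R^{2m}$ (the same choice, and the same $n$, for all $R$). Let $\alpha\in\mathrm S(n,A)$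 with $\alpha^+(0)=\mathrm I_n$. If $\alpha_{\mathfrak p}\in[\mathrm S(n,A_{\mathfrak p}),\mathrm S(n,A_{\mathfrak p})]$ for every prime ideal $\mathfrak p$ of $A_0$, then $\alpha\in[\mathrm S(n,A),\mathrm S(n,A)]$. -/

import Mathlib

namespace GradedLG

open Polynomial

section Grading

variable {A : Type*} [CommRing A] (𝒜 : ℕ → AddSubgroup A) [GradedRing 𝒜]

/-- The ring homomorphism `ε : A → A[X]` attached to an `ℕ`-graded ring `A = A₀ ⊕ A₁ ⊕ ⋯`,
sending `b = b₀ + b₁ + b₂ + ⋯` to `b₀ + b₁ X + b₂ X² + ⋯`. -/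
noncomputable def eps : A →+* A[X] :=
  (DirectSum.toSemiring (A := fun i => 𝒜 i)
    (fun i => ((monomial i : A →ₗ[A] A[X]).toAddMonoidHom).comp (𝒜 i).subtype)
    (by simp)
    (by
      intro i j a b
      simp [monomial_mul_monomial])).comp
    (DirectSum.decomposeRingEquiv 𝒜).toRingHom

/-- `b ↦ b⁺(a) = ε(b)(a)` for a fixed `a ∈ A₀`. -/
noncomputable def plus (a : 𝒜 0) : A →+* A :=
  (evalRingHom (a : A)).comp (eps 𝒜)

/-- The coefficient of `X ^ i` in `ε(b)` is the homogeneous component `b_i`. -/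
theorem coeff_eps (b : A) (i : ℕ) :
    (eps 𝒜 b).coeff i = (DirectSum.decompose 𝒜 b i : A) := by
  induction b using DirectSum.Decomposition.inductionOn 𝒜 with
  | zero => simp
  | @homogeneous j b =>
    have h : eps 𝒜 (b : A) = monomial j (b : A) := by
      simp only [eps, DirectSum.decomposeRingEquiv, RingHom.comp_apply]
      change DirectSum.toAddMonoid _ (DirectSum.decompose 𝒜 (b : A)) = _
      rw [DirectSum.decompose_coe, DirectSum.toAddMonoid_of]
      rfl
    rw [h, coeff_monomial, DirectSum.decompose_coe, DirectSum.coe_of_apply]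
    split_ifs <;> simp
  | add x y hx hy => simp [hx, hy, DirectSum.decompose_add]

/-- `b⁺(0) = b₀`. -/
theorem plus_zero (b : A) : plus 𝒜 0 b = (DirectSum.decompose 𝒜 b 0 : A) := by
  rw [← coeff_eps, plus, RingHom.comp_apply, coe_evalRingHom, AddSubgroup.coe_zero,
    ← coeff_zero_eq_eval_zero]

/-- The localization `A_𝔭` of `A` at the multiplicative set `A₀ ∖ 𝔭`, for a prime `𝔭` of the
degree-zero subring `A₀`. -/
abbrev LocAt (p : PrimeSpectrum (𝒜 0)) : Type _ :=
  Localization (Algebra.algebraMapSubmonoid A p.asIdeal.primeCompl)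

end Grading

/-- The homomorphism of symplectic groups `Sp_{2m}(R) → Sp_{2m}(S)` obtained by applying a ring
homomorphism to the entries of a matrix. -/
def symplecticMap {R S : Type*} [CommRing R] [CommRing S] (m : ℕ) (f : R →+* S) :
    Matrix.symplecticGroup (Fin m) R →* Matrix.symplecticGroup (Fin m) S where
  toFun g := ⟨(g : Matrix (Fin m ⊕ Fin m) (Fin m ⊕ Fin m) R).map f, by
    have h := congrArg (fun M => f.mapMatrix M) (SymplecticGroup.mem_iff.1 g.2)
    rw [SymplecticGroup.mem_iff]
    simpa [Matrix.map_mul, Matrix.map_J, Matrix.transpose_map] using h⟩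
  map_one' := by ext; simp [Matrix.one_apply, apply_ite f]
  map_mul' g h := Subtype.ext (Matrix.map_mul (f := f))

end GradedLG

open Polynomial
open scoped commutatorElement

universe u

/-! Write E(R) for the subgroup generated by the root elements. They are commutators, so it suffices
to prove α ∈ E(A). Everything uniform in SL and Sp is proved once from the axioms of
`ElementaryFunctor`; the two groups are then shown to satisfy them.

Read ε as a homotopy from α⁺(0) = 1 to α. For a ∈ A₀ ask whether moving its parameter by any
multiple of a preserves the class modulo E(A). Such a form an ideal. If α_𝔭 ∈ E(A_𝔭), a dilation
argument puts some a ∉ 𝔭 in it: after rescaling a variable by a denominator, an elementary matrix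
over a localization that is trivial at X = 0 descends. If this holds at all 𝔭, the ideal contains 1,
and moving from 0 to 1 gives α ∈ E(A) (`map_eval_one_mul_inv_mem_elementary`).

It remains to pass from [G, G] to E over A_𝔭, which need not be local. The same principle for R[X],
with generation by root elements over local rings, gives that E(R) is normal and that elements
homotopic to 1 are central modulo E(R). Since ε extends to A_𝔭, each x differs from x⁺(0) by a
factor central modulo E, so [x, y] ≡ [x⁺(0), y⁺(0)]. Hence an element of [G, G] with trivial
degree-zero part lies in E (`mem_elementary_of_mem_commutator`). -/

/-- A group-valued functor on commutative rings with separating coordinates, together with additive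
root elements that satisfy a denominator-clearing form of the commutator relations, are products of
commutators, and generate the group over local rings. -/
structure ElementaryFunctor where
  obj (R : Type u) [CommRing R] : Type u
  group (R : Type u) [CommRing R] : Group (obj R)
  map {R S : Type u} [CommRing R] [CommRing S] (f : R →+* S) : obj R →* obj S
  Entry : Type
  finite_entry : Finite Entry
  entry {R : Type u} [CommRing R] : obj R → Entry → R
  entry_injective {R : Type u} [CommRing R] : Function.Injective (entry (R := R))
  entry_map {R S : Type u} [CommRing R] [CommRing S] (f : R →+* S) (g : obj R) (k : Entry) :
    entry (map f g) k = f (entry g k)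
  Root : Type
  root {R : Type u} [CommRing R] : Root → R → obj R
  root_add {R : Type u} [CommRing R] (a : Root) (r s : R) : root a (r + s) = root a r * root a s
  map_root {R S : Type u} [CommRing R] [CommRing S] (f : R →+* S) (a : Root) (r : R) :
    map f (root a r) = root a (f r)
  -- Here d is a denominator of c relative to S. The powers 6 and 3 leave room to split the
  -- parameter into factors, each of which absorbs denominators and still keeps a factor t.
  root_conj_mem {R : Type u} [CommRing R] (S : Subring R) {t d c f : R} (ht : t ∈ S) (hd : d ∈ S)
    (hc : d * c ∈ S) (hf : f ∈ S) (a b : Root) :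
    root b c * root a (d ^ 6 * t ^ 3 * f) * (root b c)⁻¹ ∈
      Subgroup.closure {g | ∃ a, ∃ f ∈ S, g = root a (t * f)}
  root_mem_commutator {R : Type u} [CommRing R] (a : Root) (r : R) : root a r ∈ commutator (obj R)
  closure_root_of_isLocalRing {R : Type u} [CommRing R] [IsLocalRing R] :
    Subgroup.closure {g : obj R | ∃ a r, g = root a r} = ⊤

/-! ### The elementary subgroup. -/

namespace ElementaryFunctor

attribute [instance] ElementaryFunctor.group ElementaryFunctor.finite_entry

variable (G : ElementaryFunctor.{u}) {R S T : Type u} [CommRing R] [CommRing S] [CommRing T]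

theorem map_map (f : R →+* S) (h : S →+* T) (g : G.obj R) :
    G.map h (G.map f g) = G.map (h.comp f) g :=
  G.entry_injective (by ext k; simp [G.entry_map])

theorem map_id (g : G.obj R) : G.map (RingHom.id R) g = g :=
  G.entry_injective (by ext k; simp [G.entry_map])

theorem root_zero (a : G.Root) : G.root a (0 : R) = 1 := by
  simpa using G.root_add a (0 : R) 0

theorem root_neg (a : G.Root) (r : R) : G.root a (-r) = (G.root a r)⁻¹ := by
  rw [eq_inv_iff_mul_eq_one, ← G.root_add, neg_add_cancel, root_zero]

variable (R) in
/-- The subgroup generated by the root elements. -/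
def elementary : Subgroup (G.obj R) := Subgroup.closure {g | ∃ a r, g = G.root a r}

theorem root_mem (a : G.Root) (r : R) : G.root a r ∈ G.elementary R :=
  Subgroup.subset_closure ⟨a, r, rfl⟩

theorem elementary_induction {p : G.obj R → Prop} (one : p 1)
    (mul : ∀ a r g, p g → p (G.root a r * g)) {g : G.obj R} (hg : g ∈ G.elementary R) : p g := by
  induction hg using Subgroup.closure_induction_left with
  | one => exact one
  | mul_left x hx y _ hy => obtain ⟨a, r, rfl⟩ := hx; exact mul a r y hy
  | inv_mul_cancel x hx y _ hy =>
    obtain ⟨a, r, rfl⟩ := hx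
    rw [← root_neg]
    exact mul a (-r) y hy

theorem map_mem_elementary (f : R →+* S) {g : G.obj R} (hg : g ∈ G.elementary R) :
    G.map f g ∈ G.elementary S := by
  refine G.elementary_induction (p := fun g => G.map f g ∈ G.elementary S) ?_ ?_ hg
  · rw [map_one]; exact one_mem _
  · intro a r g ih
    rw [map_mul, G.map_root]; exact mul_mem (G.root_mem _ _) ih

theorem elementary_le_commutator : G.elementary R ≤ commutator (G.obj R) := by
  rw [elementary, Subgroup.closure_le]
  rintro _ ⟨a, r, rfl⟩
  exact G.root_mem_commutator a r

theorem mem_elementary_of_isLocalRing [IsLocalRing R] (g : G.obj R) : g ∈ G.elementary R := by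
  rw [elementary, G.closure_root_of_isLocalRing]
  trivial

/-- The subgroup generated by the root elements with parameter in `t • S`. -/
def rootSubgroup (S : Subring R) (t : R) : Subgroup (G.obj R) :=
  Subgroup.closure {g | ∃ a, ∃ f ∈ S, g = G.root a (t * f)}

theorem rootSubgroup_conj_mem (S : Subring R) {t d c : R} (ht : t ∈ S) (hd : d ∈ S)
    (hc : d * c ∈ S) (b : G.Root) {g : G.obj R} (hg : g ∈ G.rootSubgroup S (d ^ 6 * t ^ 3)) :
    G.root b c * g * (G.root b c)⁻¹ ∈ G.rootSubgroup S t := by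
  suffices h : G.rootSubgroup S (d ^ 6 * t ^ 3) ≤
      (G.rootSubgroup S t).comap (MulAut.conj (G.root b c)).toMonoidHom from h hg
  rw [rootSubgroup, Subgroup.closure_le]
  rintro _ ⟨a, f, hf, rfl⟩
  exact G.root_conj_mem S ht hd hc hf a b

end ElementaryFunctor

/-! ### Rescaling the variable of a polynomial. -/

section Scale

variable {R S : Type*} [CommRing R] [CommRing S]

/-- The substitution `X ↦ c X`. -/
noncomputable def Polynomial.scale (c : R) : R[X] →+* R[X] := eval₂RingHom C (C c * X)

theorem Polynomial.coeff_scale (c : R) (p : R[X]) (n : ℕ) :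
    (scale c p).coeff n = c ^ n * p.coeff n := by
  induction p using Polynomial.induction_on' with
  | add p q hp hq => simp [hp, hq, mul_add]
  | monomial k a =>
    simp only [scale, coe_eval₂RingHom, eval₂_monomial, mul_pow, ← C_pow, ← mul_assoc, ← C_mul,
      coeff_C_mul, coeff_X_pow, coeff_monomial]
    split_ifs with h1 h2 h2 <;> grind

theorem Polynomial.scale_scale (c d : R) (p : R[X]) : scale c (scale d p) = scale (c * d) p := by
  ext n; simp only [coeff_scale]; ring

theorem Polynomial.scale_zero (p : R[X]) : scale 0 p = C (p.coeff 0) := by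
  ext n; cases n <;> simp [coeff_scale]

theorem Polynomial.scale_C (c r : R) : scale c (C r) = C r := by simp [scale]

theorem Polynomial.map_scale (f : R →+* S) (c : R) (p : R[X]) :
    (scale c p).map f = scale (f c) (p.map f) := by
  ext n; simp [coeff_scale]

variable [Algebra R S] (M : Submonoid R) [IsLocalization M S]

theorem Polynomial.exists_C_mul_eq_map (p : S[X]) :
    ∃ m ∈ M, ∃ q : R[X], C (algebraMap R S m) * p = q.map (algebraMap R S) := by
  obtain ⟨m, hm, h⟩ := IsLocalization.integerNormalization_spec M p
  refine ⟨m, hm, IsLocalization.integerNormalization M p, ?_⟩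
  rw [h, ← smul_eq_C_mul, algebraMap_smul]

attribute [local instance] Polynomial.algebra Polynomial.isLocalization in
theorem Polynomial.exists_C_mul_eq_of_map_eq {p q : R[X]}
    (h : p.map (algebraMap R S) = q.map (algebraMap R S)) : ∃ m ∈ M, C m * p = C m * q := by
  obtain ⟨⟨_, m, hm, rfl⟩, h⟩ := (IsLocalization.eq_iff_exists (M.map C) S[X]).1 h
  exact ⟨m, hm, h⟩

/-- Scaling multiplies each nonconstant coefficient by a multiple of m, but leaves the constant term
alone; hence the separate assumption there. -/
theorem Polynomial.scale_eq_of_C_mul_eq {m c : R} {p q : R[X]} (h : C m * p = C m * q)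
    (h0 : p.coeff 0 = q.coeff 0) (hc : m ∣ c) : scale c p = scale c q := by
  obtain ⟨d, rfl⟩ := hc
  ext n
  cases n with
  | zero => simp [coeff_scale, h0]
  | succ n =>
    have := congrArg (fun r => r.coeff (n + 1)) h
    simp only [coeff_C_mul] at this
    simp only [coeff_scale]
    linear_combination (m * d) ^ n * d * this

/-- After scaling the variable by a multiple of a suitable denominator, the nonconstant part of a
polynomial over a localization is a multiple of `t` in the image of `R[X]`. -/
theorem Polynomial.exists_scale_sub_scale_zero (t : R) (p : S[X]) :
    ∃ m ∈ M, ∀ c : R, ∃ q : R[X], scale (algebraMap R S (t * m * c)) p - scale 0 p =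
      (C t * q).map (algebraMap R S) := by
  -- The nonconstant part is X times `p.divX`; scaling turns this X into t * m * c * X, whose m
  -- clears the denominators of `p.divX` and whose t survives.
  obtain ⟨m, hm, q, hq⟩ := exists_C_mul_eq_map (R := R) M p.divX
  refine ⟨m, hm, fun c => ⟨C c * X * scale (t * m * c) q, ?_⟩⟩
  have h0 : scale (algebraMap R S (t * m * c)) p - scale 0 p =
      C (algebraMap R S (t * m * c)) * X * scale (algebraMap R S (t * m * c)) p.divX := by
    ext n
    cases n <;> simp [coeff_scale, mul_assoc, pow_succ', coeff_X_mul]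
  have h1 : (scale (t * m * c) q).map (algebraMap R S) =
      C (algebraMap R S m) * scale (algebraMap R S (t * m * c)) p.divX := by
    rw [map_scale, ← hq, map_mul, scale_C]
  rw [h0]
  simp only [Polynomial.map_mul, h1, map_C, map_X, map_mul]
  ring

end Scale

/-! ### Dilation over a localization. -/

namespace ElementaryFunctor

variable (G : ElementaryFunctor.{u}) {R S T : Type u} [CommRing R] [CommRing S] [CommRing T]

theorem map_eq_map_of_forall_entry {f h : R →+* S} {g g' : G.obj R}
    (H : ∀ k, f (G.entry g k) = h (G.entry g' k)) : G.map f g = G.map h g' :=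
  G.entry_injective (by ext k; simp [G.entry_map, H])

theorem map_scale_map_scale (c d : R) (g : G.obj R[X]) :
    G.map (scale c) (G.map (scale d) g) = G.map (scale (c * d)) g := by
  rw [G.map_map]
  exact G.map_eq_map_of_forall_entry fun k => scale_scale _ _ _

section Localization

variable [Algebra R S] (M : Submonoid R) [IsLocalization M S]

theorem map_mapRingHom_scale (c : R) (g : G.obj R[X]) :
    G.map (mapRingHom (algebraMap R S)) (G.map (scale c) g) =
      G.map (scale (algebraMap R S c)) (G.map (mapRingHom (algebraMap R S)) g) := by
  rw [G.map_map, G.map_map]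
  exact G.map_eq_map_of_forall_entry fun k => map_scale _ _ _

/-- There are finitely many entries, so the product of their denominators serves all of them. -/
theorem exists_map_scale_eq {g h : G.obj R[X]}
    (H : G.map (mapRingHom (algebraMap R S)) g = G.map (mapRingHom (algebraMap R S)) h)
    (H0 : G.map (scale 0) g = G.map (scale 0) h) :
    ∃ m ∈ M, G.map (scale m) g = G.map (scale m) h := by
  cases nonempty_fintype G.Entry
  have key (k : G.Entry) : ∃ m ∈ M, C m * G.entry g k = C m * G.entry h k := by
    apply exists_C_mul_eq_of_map_eq (S := S)
    simpa only [G.entry_map, coe_mapRingHom] using congrArg (fun x => G.entry x k) H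
  choose m hm h using key
  refine ⟨∏ k, m k, prod_mem fun k _ => hm k, G.map_eq_map_of_forall_entry fun k => ?_⟩
  refine scale_eq_of_C_mul_eq (h k) ?_ (Finset.dvd_prod_of_mem m (Finset.mem_univ k))
  have := congrArg (fun x => G.entry x k) H0
  simpa [G.entry_map, scale_zero] using this

theorem rootSubgroup_le_map (t : R) :
    G.rootSubgroup (mapRingHom (algebraMap R S)).range (C (algebraMap R S t)) ≤
      (G.elementary R[X]).map (G.map (mapRingHom (algebraMap R S))) := by
  rw [rootSubgroup, Subgroup.closure_le]
  rintro _ ⟨a, _, ⟨f, rfl⟩, rfl⟩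
  exact ⟨G.root a (C t * f), G.root_mem _ _, by simp [G.map_root]⟩

/-- Induction on word length. A scaled first factor splits as a root element with parameter in t
times the image of R[X], times its value at X = 0. The latter conjugates the tail, and its parameter
has a denominator d; so the tail is taken at level d ^ 6 * t ^ 3, which requires all t in the
induction. -/
theorem exists_map_scale_mem_rootSubgroup {g : G.obj S[X]} (hg : g ∈ G.elementary S[X]) :
    ∀ t ∈ M, ∃ m ∈ M, ∀ c : R,
      G.map (scale (algebraMap R S (m * c))) g * (G.map (scale 0) g)⁻¹ ∈
        G.rootSubgroup (mapRingHom (algebraMap R S)).range (C (algebraMap R S t)) := by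
  refine G.elementary_induction (p := fun g => ∀ t ∈ M, ∃ m ∈ M, ∀ c : R,
      G.map (scale (algebraMap R S (m * c))) g * (G.map (scale 0) g)⁻¹ ∈
        G.rootSubgroup (mapRingHom (algebraMap R S)).range (C (algebraMap R S t))) ?_ ?_ hg
  · intro t ht
    exact ⟨1, one_mem _, fun c => by simp [one_mem]⟩
  · intro a f g ih t ht
    have hC (r : R) : C (algebraMap R S r) ∈ (mapRingHom (algebraMap R S)).range :=
      ⟨C r, by simp⟩
    obtain ⟨⟨w, d⟩, hd⟩ := IsLocalization.surj M (f.coeff 0)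
    obtain ⟨m₁, hm₁, h₁⟩ := exists_scale_sub_scale_zero M t f
    obtain ⟨m₂, hm₂, h₂⟩ := ih (d ^ 6 * t ^ 3) (mul_mem (pow_mem d.2 _) (pow_mem ht _))
    refine ⟨t * m₁ * m₂, mul_mem (mul_mem ht hm₁) hm₂, fun c => ?_⟩
    obtain ⟨q, hq⟩ := h₁ (m₂ * c)
    specialize h₂ (t * m₁ * c)
    simp only [← mul_assoc] at hq
    rw [show m₂ * (t * m₁ * c) = t * m₁ * m₂ * c by ring] at h₂
    simp only [map_mul, map_pow] at h₂
    have h₃ := G.rootSubgroup_conj_mem (c := C (f.coeff 0)) _ (hC t) (hC d) ?_ a h₂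
    · simp only [map_mul (G.map _), G.map_root, ← scale_zero] at h₃ ⊢
      have hsplit : scale (algebraMap R S (t * m₁ * m₂ * c)) f =
          (C t * q).map (algebraMap R S) + scale 0 f := by rw [← hq]; ring
      rw [hsplit, G.root_add]
      have h₄ : G.root a ((C t * q).map (algebraMap R S)) ∈
          G.rootSubgroup (mapRingHom (algebraMap R S)).range (C (algebraMap R S t)) :=
        Subgroup.subset_closure ⟨a, q.map (algebraMap R S), ⟨q, rfl⟩, by simp⟩
      convert mul_mem h₄ h₃ using 1
      simp only [map_mul]
      group
    · rw [← C_mul, mul_comm, hd]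
      exact hC w

/-- Dilation: an element over `R[X]` that is trivial at `X = 0` and elementary over a localization
becomes elementary after scaling the variable by a denominator. -/
theorem exists_map_scale_mem_elementary {g : G.obj R[X]} (h0 : G.map (scale 0) g = 1)
    (hg : G.map (mapRingHom (algebraMap R S)) g ∈ G.elementary S[X]) :
    ∃ m ∈ M, G.map (scale m) g ∈ G.elementary R[X] := by
  obtain ⟨m, hm, h⟩ := G.exists_map_scale_mem_rootSubgroup M hg 1 (one_mem M)
  specialize h 1
  have h0' := G.map_mapRingHom_scale (S := S) 0 g
  rw [map_zero, h0, map_one] at h0'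
  rw [← h0', inv_one, mul_one, mul_one, ← map_mapRingHom_scale] at h
  obtain ⟨e, he, h⟩ := G.rootSubgroup_le_map _ h
  -- The lift e need not be trivial at X = 0, but its value there dies over S. Dividing by that
  -- value keeps e a lift and makes the constant terms agree, so one more denominator gives equality
  -- over R[X].
  have he0 : G.map (mapRingHom (algebraMap R S)) (G.map (scale 0) e) = 1 := by
    rw [map_mapRingHom_scale, h, ← map_mapRingHom_scale, map_scale_map_scale, zero_mul, h0, map_one]
  obtain ⟨m', hm', h'⟩ := G.exists_map_scale_eq (S := S) M (g := G.map (scale m) g)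
    (h := e * (G.map (scale 0) e)⁻¹) (by rw [map_mul, map_inv, he0, h, inv_one, mul_one])
    (by rw [map_scale_map_scale, zero_mul, h0, map_mul, map_inv, map_scale_map_scale, zero_mul,
      mul_inv_cancel])
  refine ⟨m' * m, mul_mem hm' hm, ?_⟩
  rw [← map_scale_map_scale, h']
  exact G.map_mem_elementary _ (mul_mem he (inv_mem (G.map_mem_elementary _ he)))

end Localization

end ElementaryFunctor

/-! ### Local-global principles and their consequences. -/

namespace ElementaryFunctor

variable (G : ElementaryFunctor.{u}) {R S T : Type u} [CommRing R] [CommRing S] [CommRing T]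

theorem map_mem_elementary_of_isUnit (M : Submonoid R) [Algebra R S] [IsLocalization M S]
    {g : G.obj R} (hg : G.map (algebraMap R S) g ∈ G.elementary S) (f : R →+* T)
    (hf : ∀ m : M, IsUnit (f m)) : G.map f g ∈ G.elementary T := by
  rw [← IsLocalization.lift_comp (S := S) hf, ← G.map_map]
  exact G.map_mem_elementary _ hg

section LocalGlobal

variable {A₀ : Type*} {A : Type u} [CommRing A₀] [CommRing A] [Algebra A₀ A]

/-- The localization of `A` at the complement of a prime ideal of `A₀`. -/
abbrev LocalizationAt (A : Type u) [CommRing A] [Algebra A₀ A] (p : PrimeSpectrum A₀) : Type u :=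
  Localization (Algebra.algebraMapSubmonoid A p.asIdeal.primeCompl)

attribute [local instance] Polynomial.algebra Polynomial.isLocalization in
/-- Near a prime `p` of `A₀`, moving the parameter of a homotopy by multiples of a suitable
`a ∉ p` does not change the class modulo the elementary subgroup. -/
theorem exists_map_eval_add_mem_elementary (φ : A →+* A[X])
    (hφ : ∀ a : A₀, φ (algebraMap A₀ A a) = C (algebraMap A₀ A a)) (g : G.obj A)
    (p : PrimeSpectrum A₀)
    (hg : G.map (algebraMap A (LocalizationAt A p)) g ∈ G.elementary (LocalizationAt A p)) :
    ∃ a ∉ p.asIdeal, ∀ t c : A,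
      G.map ((evalRingHom (t + algebraMap A₀ A a * c)).comp φ) g *
        (G.map ((evalRingHom t).comp φ) g)⁻¹ ∈ G.elementary A := by
  set M := Algebra.algebraMapSubmonoid A p.asIdeal.primeCompl
  set L := LocalizationAt A p
  -- With Y the inner variable and X the outer one, θ compares the homotopy at Y + X with the
  -- homotopy at Y.
  let φ₁ : A →+* A[X][X] := (eval₂RingHom (C.comp C) (C X + X)).comp φ
  let φ₂ : A →+* A[X][X] := C.comp φ
  let θ := G.map φ₁ g * (G.map φ₂ g)⁻¹
  have hθ0 : G.map (scale 0) θ = 1 := by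
    have h1 : (scale 0).comp φ₁ = φ₂ := by
      have : (scale (0 : A[X])).comp (eval₂RingHom ((C : A[X] →+* A[X][X]).comp C) (C X + X)) =
          C := by
        ext1 <;> simp [scale]
        ext1
        simp
      rw [← RingHom.comp_assoc, this]
    have h2 : (scale 0).comp φ₂ = φ₂ := by ext1; simp [φ₂, scale]
    rw [map_mul, map_inv, G.map_map, G.map_map, h1, h2, mul_inv_cancel]
  -- Such a ψ sends the denominators from A₀ to constants that are units over L, so it carries the
  -- elementary element over L to one over L[Y][X].
  have hunit (ψ : A →+* A[X][X])
      (hψ : ∀ a : A₀, ψ (algebraMap A₀ A a) = C (C (algebraMap A₀ A a))) :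
      G.map (mapRingHom (algebraMap A[X] L[X])) (G.map ψ g) ∈ G.elementary L[X][X] := by
    rw [G.map_map]
    refine G.map_mem_elementary_of_isUnit (S := L) M hg _ ?_
    rintro ⟨_, a, ha, rfl⟩
    have : IsUnit (algebraMap A L (algebraMap A₀ A a)) :=
      IsLocalization.map_units (M := M) L ⟨_, a, ha, rfl⟩
    simpa [hψ, Polynomial.algebraMap_def] using (this.map (C : L →+* L[X])).map (C : L[X] →+* L[X][X])
  have hθ : G.map (mapRingHom (algebraMap A[X] L[X])) θ ∈ G.elementary L[X][X] := by
    rw [map_mul, map_inv]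
    exact mul_mem (hunit _ (by simp [φ₁, hφ])) (inv_mem (hunit _ (by simp [φ₂, hφ])))
  obtain ⟨_, ⟨_, ⟨a, ha, rfl⟩, rfl⟩, h⟩ :=
    G.exists_map_scale_mem_elementary (S := L[X]) (M.map C) hθ0 hθ
  refine ⟨a, ha, fun t c => ?_⟩
  -- After the scaling X ↦ aX, specialize X to c and then Y to t.
  have := G.map_mem_elementary ((evalRingHom t).comp (evalRingHom (C c))) h
  simp only [map_mul, map_inv, G.map_map, θ] at this
  have e1 : (evalRingHom t).comp ((evalRingHom (C c)).comp ((scale (C (algebraMap A₀ A a))).comp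
      (eval₂RingHom ((C : A[X] →+* A[X][X]).comp C) (C X + X)))) =
      evalRingHom (t + algebraMap A₀ A a * c) := by
    ext1 <;> simp [scale]
    ext1; simp
  have e2 : (evalRingHom t).comp ((evalRingHom (C c)).comp ((scale (C (algebraMap A₀ A a))).comp
      (C : A[X] →+* A[X][X]))) = evalRingHom t := by
    ext1 <;> simp [scale]
    ext1; simp
  have e1' := congrArg (fun f => RingHom.comp f φ) e1
  have e2' := congrArg (fun f => RingHom.comp f φ) e2
  rw [← e1', ← e2']
  exact this

/-- Local-global principle for the elementary subgroup along a homotopy over `A₀`. -/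
theorem map_eval_one_mul_inv_mem_elementary (φ : A →+* A[X])
    (hφ : ∀ a : A₀, φ (algebraMap A₀ A a) = C (algebraMap A₀ A a)) (g : G.obj A)
    (hg : ∀ p : PrimeSpectrum A₀,
      G.map (algebraMap A (LocalizationAt A p)) g ∈ G.elementary (LocalizationAt A p)) :
    G.map ((evalRingHom 1).comp φ) g * (G.map ((evalRingHom 0).comp φ) g)⁻¹ ∈ G.elementary A := by
  let F (t : A) : G.obj A := G.map ((evalRingHom t).comp φ) g
  -- Closure under addition is two consecutive moves. The ideal lies in no maximal ideal, so it
  -- contains 1; the move from 0 to 1 is the claim.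
  let I : Ideal A₀ :=
    { carrier := {a | ∀ t c : A, F (t + algebraMap A₀ A a * c) * (F t)⁻¹ ∈ G.elementary A}
      zero_mem' := fun t c => by simp [one_mem]
      add_mem' := fun {a b} ha hb t c => by
        have := mul_mem (hb (t + algebraMap A₀ A a * c) c) (ha t c)
        rwa [← mul_assoc, inv_mul_cancel_right, add_assoc, ← add_mul, ← map_add] at this
      smul_mem' := fun r a ha t c => by
        have := ha t (algebraMap A₀ A r * c)
        rwa [← mul_assoc, ← map_mul, mul_comm a] at this }
  have hI : I = ⊤ := by
    by_contra hI
    obtain ⟨p, hp, hIp⟩ := Ideal.exists_le_maximal I hI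
    obtain ⟨a, ha, h⟩ := G.exists_map_eval_add_mem_elementary φ hφ g ⟨p, hp.isPrime⟩ (hg _)
    exact ha (hIp h)
  have h1 : (1 : A₀) ∈ I := hI ▸ Submodule.mem_top
  simpa [F] using h1 0 1

end LocalGlobal

/-- A constant element factors through the local ring of R at p, where every element is elementary.
-/
theorem map_algebraMap_C_mem_elementary (g : G.obj R) (p : PrimeSpectrum R) :
    G.map (algebraMap R[X] (LocalizationAt R[X] p)) (G.map C g) ∈
      G.elementary (LocalizationAt R[X] p) := by
  rw [G.map_map]
  refine G.map_mem_elementary_of_isUnit (S := Localization.AtPrime p.asIdeal)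
    p.asIdeal.primeCompl (G.mem_elementary_of_isLocalRing _) _ fun m => ?_
  exact IsLocalization.map_units (M := Algebra.algebraMapSubmonoid R[X] p.asIdeal.primeCompl)
    (LocalizationAt R[X] p) ⟨C m, m, m.2, rfl⟩

/-- Quillen's local-global principle for the elementary subgroup over `R[X]`. -/
theorem mem_elementary_polynomial {g : G.obj R[X]} (h0 : G.map (scale 0) g = 1)
    (hg : ∀ p : PrimeSpectrum R,
      G.map (algebraMap R[X] (LocalizationAt R[X] p)) g ∈
        G.elementary (LocalizationAt R[X] p)) :
    g ∈ G.elementary R[X] := by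
  -- The homotopy f(X) ↦ f(XY), with Y the outer variable: the constant term at Y = 0, the identity
  -- at Y = 1.
  let φ : R[X] →+* R[X][X] := eval₂RingHom (C.comp C) (C X * X)
  have h := G.map_eval_one_mul_inv_mem_elementary φ (fun a => by simp [φ, algebraMap_eq]) g hg
  have h1 : (evalRingHom 1).comp φ = RingHom.id _ := by ext1 <;> simp [φ]; ext1; simp
  have h2 : (evalRingHom 0).comp φ = scale 0 := by ext1 <;> simp [φ, scale]; ext1; simp
  rwa [h1, h2, h0, inv_one, mul_one, G.map_id] at h

theorem map_scale_zero_map_C (g : G.obj R) : G.map (scale 0) (G.map C g) = G.map C g := by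
  rw [G.map_map]
  exact G.map_eq_map_of_forall_entry fun k => scale_C _ _

theorem map_eval_map_C (t : R) (g : G.obj R) : G.map (evalRingHom t) (G.map C g) = g := by
  rw [G.map_map]
  conv_rhs => rw [← G.map_id g]
  exact G.map_eq_map_of_forall_entry fun k => eval_C

/-- Put a root element on the path with parameter rX. Its conjugate by the constant g is trivial at
X = 0 and elementary at every prime, because g is; the local-global principle applies, and X = 1
finishes. -/
instance normal_elementary : (G.elementary R).Normal := by
  constructor
  intro e he g
  refine G.elementary_induction (p := fun e => g * e * g⁻¹ ∈ G.elementary R) ?_ ?_ he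
  · simp [one_mem]
  · intro a r e ih
    have key : G.map C g * G.root a (C r * X) * (G.map C g)⁻¹ ∈ G.elementary R[X] := by
      apply G.mem_elementary_polynomial
      · simp [G.map_scale_zero_map_C, G.map_root, scale_zero, G.root_zero]
      · intro p
        have := G.map_algebraMap_C_mem_elementary g p
        rw [map_mul, map_mul, map_inv, G.map_root]
        exact mul_mem (mul_mem this (G.root_mem _ _)) (inv_mem this)
    have := G.map_mem_elementary (evalRingHom 1) key
    rw [map_mul, map_mul, map_inv, G.map_eval_map_C, G.map_root] at this
    convert mul_mem this ih using 1
    simp only [coe_evalRingHom, eval_mul, eval_C, eval_X, mul_one]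
    group

/-- Elements homotopic to the identity commute with all elements modulo the elementary subgroup. -/
theorem commutatorElement_mem_elementary {g : G.obj R[X]} (h0 : G.map (scale 0) g = 1)
    (h : G.obj R) : ⁅G.map (evalRingHom 1) g, h⁆ ∈ G.elementary R := by
  have key : ⁅g, G.map C h⁆ ∈ G.elementary R[X] := by
    apply G.mem_elementary_polynomial
    · rw [map_commutatorElement, h0, commutatorElement_one_left]
    · intro p
      have := G.map_algebraMap_C_mem_elementary h p
      rw [map_commutatorElement, commutatorElement_def]
      -- The commutator is a conjugate of h times the inverse of h, and h is elementary at p.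
      exact mul_mem (G.normal_elementary.conj_mem _ this _) (inv_mem this)
  have := G.map_mem_elementary (evalRingHom 1) key
  rwa [map_commutatorElement, G.map_eval_map_C] at this

/-- If `φ` is a homotopy from `ρ` to the identity, then elements of the commutator subgroup killed
by `ρ` are elementary. -/
theorem mem_elementary_of_mem_commutator (φ : R →+* R[X])
    (h1 : (evalRingHom 1).comp φ = RingHom.id R) {g : G.obj R}
    (h0 : G.map ((evalRingHom 0).comp φ) g = 1) (hg : g ∈ commutator (G.obj R)) :
    g ∈ G.elementary R := by
  set ρ := (evalRingHom 0).comp φ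
  let π := QuotientGroup.mk' (G.elementary R)
  -- The element x * ρ(x)⁻¹ is the value at 1 of a path starting at the identity, hence central
  -- modulo the elementary subgroup.
  have hcomm (x y : G.obj R) : Commute (π (x * (G.map ρ x)⁻¹)) (π y) := by
    have := G.commutatorElement_mem_elementary
      (g := G.map φ x * (G.map C (G.map ρ x))⁻¹) ?_ y
    · rw [map_mul, map_inv, G.map_map, h1, G.map_id, G.map_eval_map_C] at this
      rw [← commutatorElement_eq_one_iff_commute, ← map_commutatorElement]
      exact (QuotientGroup.eq_one_iff _).2 this
    · rw [map_mul, map_inv, G.map_scale_zero_map_C, G.map_map, G.map_map, mul_inv_eq_one]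
      exact G.map_eq_map_of_forall_entry fun k => by
        simp [ρ, scale_zero, coeff_zero_eq_eval_zero]
  -- Central factors do not affect commutators, so π and π ∘ ρ agree on all of them.
  have hle : commutator (G.obj R) ≤ π.eqLocus (π.comp (G.map ρ)) := by
    rw [commutator_def, Subgroup.commutator_le]
    intro x _ y _
    have hx : ∀ q, Commute _ q := (QuotientGroup.mk'_surjective _).forall.2 (hcomm x)
    have hy : ∀ q, Commute _ q := (QuotientGroup.mk'_surjective _).forall.2 (hcomm y)
    generalize hz : π (x * (G.map ρ x)⁻¹) = z at hx
    generalize hw : π (y * (G.map ρ y)⁻¹) = w at hy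
    have ex : π x = z * π (G.map ρ x) := by rw [← hz, ← map_mul, inv_mul_cancel_right]
    have ey : π y = w * π (G.map ρ y) := by rw [← hw, ← map_mul, inv_mul_cancel_right]
    change π ⁅x, y⁆ = π (G.map ρ ⁅x, y⁆)
    rw [map_commutatorElement, map_commutatorElement, map_commutatorElement, ex, ey]
    generalize π (G.map ρ x) = a
    generalize π (G.map ρ y) = b
    have e1 : z * a * (w * b) = z * w * (a * b) := by
      rw [mul_assoc z, ← mul_assoc _ w, ← (hy _).eq]; simp only [mul_assoc]
    have e2 : w * b * (z * a) = z * w * (b * a) := by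
      rw [mul_assoc w, ← mul_assoc _ z, ← (hx _).eq, (hx w).eq]; simp only [mul_assoc]
    have key (a b : G.obj R ⧸ G.elementary R) : ⁅a, b⁆ = a * b * (b * a)⁻¹ := by
      rw [commutatorElement_def, mul_inv_rev, ← mul_assoc]
    rw [key, key, e1, e2, (((hx _).mul_left (hy _)) : Commute (z * w) (a * b)).eq,
      (((hx _).mul_left (hy _)) : Commute (z * w) (b * a)).eq, mul_inv_rev,
      mul_assoc (a * b), mul_inv_cancel_left]
  have := hle hg
  change π g = π (G.map ρ g) at this
  rw [h0, map_one] at this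
  exact (QuotientGroup.eq_one_iff _).1 this

/-! ### Graded rings. -/

section Graded

variable {A : Type u} [CommRing A] (𝒜 : ℕ → AddSubgroup A) [GradedRing 𝒜]

theorem eps_of_mem_zero (a : 𝒜 0) : GradedLG.eps 𝒜 (a : A) = C (a : A) := by
  ext n
  rw [GradedLG.coeff_eps, DirectSum.decompose_coe, DirectSum.coe_of_apply, coeff_C]
  simp only [eq_comm (a := n)]
  split_ifs <;> rfl

theorem eval_one_comp_eps : (evalRingHom 1).comp (GradedLG.eps 𝒜) = RingHom.id A := by
  ext b
  induction b using DirectSum.Decomposition.inductionOn 𝒜 with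
  | zero => simp
  | @homogeneous j b =>
    have h : GradedLG.eps 𝒜 (b : A) = monomial j (b : A) := by
      ext n
      rw [GradedLG.coeff_eps, coeff_monomial, DirectSum.decompose_coe, DirectSum.coe_of_apply]
      split_ifs <;> rfl
    simp [h]
  | add x y hx hy => rw [map_add, hx, hy, map_add]

/-- Local-global principle for commutators over a graded ring. -/
theorem mem_commutator_of_forall_localizationAt (g : G.obj A)
    (h0 : G.map (GradedLG.plus 𝒜 0) g = 1)
    (hg : ∀ p : PrimeSpectrum (𝒜 0),
      G.map (algebraMap A (GradedLG.LocAt 𝒜 p)) g ∈ commutator (G.obj (GradedLG.LocAt 𝒜 p))) :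
    g ∈ commutator (G.obj A) := by
  have hε (a : 𝒜 0) : GradedLG.eps 𝒜 (algebraMap (𝒜 0) A a) = C (algebraMap (𝒜 0) A a) :=
    eps_of_mem_zero 𝒜 a
  apply G.elementary_le_commutator
  have h := G.map_eval_one_mul_inv_mem_elementary (GradedLG.eps 𝒜) hε g fun p => ?_
  · rwa [eval_one_comp_eps, G.map_id, show (evalRingHom 0).comp (GradedLG.eps 𝒜) =
      GradedLG.plus 𝒜 0 from rfl, h0, inv_one, mul_one] at h
  · let M := Algebra.algebraMapSubmonoid A p.asIdeal.primeCompl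
    let L := GradedLG.LocAt 𝒜 p
    -- ε fixes A₀ as constants, so it extends to a homotopy L → L[X] from the degree-zero projection
    -- to the identity.
    have hu (m : M) : IsUnit ((mapRingHom (algebraMap A L)).comp (GradedLG.eps 𝒜) m) := by
      obtain ⟨_, a, ha, rfl⟩ := m
      have : IsUnit (algebraMap A L (algebraMap (𝒜 0) A a)) :=
        IsLocalization.map_units (M := M) L ⟨_, a, ha, rfl⟩
      rw [RingHom.comp_apply, hε, coe_mapRingHom, map_C]
      exact this.map C
    let φ : L →+* L[X] := IsLocalization.lift hu
    have hφ : φ.comp (algebraMap A L) = (mapRingHom (algebraMap A L)).comp (GradedLG.eps 𝒜) :=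
      IsLocalization.lift_comp hu
    have heval (t : A) : (evalRingHom (algebraMap A L t)).comp (mapRingHom (algebraMap A L)) =
        (algebraMap A L).comp (evalRingHom t) := by
      ext1
      · ext1; simp
      · simp
    refine G.mem_elementary_of_mem_commutator φ ?_ ?_ (hg p)
    · apply IsLocalization.ringHom_ext M
      rw [RingHom.comp_assoc, hφ, ← RingHom.comp_assoc, ← map_one (algebraMap A L), heval,
        RingHom.comp_assoc, eval_one_comp_eps]
      rfl
    · rw [G.map_map, RingHom.comp_assoc, hφ, ← RingHom.comp_assoc, ← map_zero (algebraMap A L),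
        heval, RingHom.comp_assoc, ← G.map_map]
      exact (congrArg _ h0).trans (map_one _)

end Graded

end ElementaryFunctor

/-! ### The special linear group. -/

namespace Matrix.SpecialLinearGroup

variable {ι : Type*} [Fintype ι] [DecidableEq ι] {R : Type*} [CommRing R]

theorem transvection_conj_of_ne {i j k l : ι} (hij : i ≠ j) (hkl : k ≠ l) (hjk : j ≠ k)
    (hil : i ≠ l) (c r : R) :
    transvection hij c * transvection hkl r * (transvection hij c)⁻¹ = transvection hkl r := by
  rw [mul_inv_eq_iff_eq_mul]
  apply Subtype.ext
  change Matrix.transvection i j c * Matrix.transvection k l r =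
    Matrix.transvection k l r * Matrix.transvection i j c
  simp [Matrix.transvection, mul_add, add_mul, hjk, hil.symm]
  abel

theorem transvection_conj_right {i j k : ι} (hij : i ≠ j) (hjk : j ≠ k) (hik : i ≠ k) (c r : R) :
    transvection hij c * transvection hjk r * (transvection hij c)⁻¹ =
      transvection hik (c * r) * transvection hjk r := by
  rw [mul_inv_eq_iff_eq_mul]
  apply Subtype.ext
  change Matrix.transvection i j c * Matrix.transvection j k r =
    Matrix.transvection i k (c * r) * Matrix.transvection j k r * Matrix.transvection i j c
  simp [Matrix.transvection, mul_add, add_mul, hik.symm, hjk.symm]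
  abel

theorem transvection_conj_left {i j k : ι} (hij : i ≠ j) (hki : k ≠ i) (hkj : k ≠ j) (c r : R) :
    transvection hij c * transvection hki r * (transvection hij c)⁻¹ =
      transvection hkj (-(r * c)) * transvection hki r := by
  rw [mul_inv_eq_iff_eq_mul]
  apply Subtype.ext
  change Matrix.transvection i j c * Matrix.transvection k i r =
    Matrix.transvection k j (-(r * c)) * Matrix.transvection k i r * Matrix.transvection i j c
  simp only [Matrix.transvection, show single k j (-(r * c)) = -single k j (r * c) by
    ext; simp [single_apply, neg_ite]]
  simp [mul_add, add_mul, hij.symm, hkj.symm]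
  abel

theorem transvection_eq_commutatorElement {i j k : ι} (hij : i ≠ j) (hik : i ≠ k) (hkj : k ≠ j)
    (c r : R) :
    transvection hij (c * r) = ⁅transvection hik c, transvection hkj r⁆ := by
  rw [commutatorElement_def, transvection_conj_right hik hkj hij, mul_inv_cancel_right]

variable (ι) in
/-- The subgroup generated by the transvections with coefficient in `T`. -/
def transvectionSubgroup (T : Set R) : Subgroup (SpecialLinearGroup ι R) :=
  Subgroup.closure {g | ∃ a : {p : ι × ι // p.1 ≠ p.2}, ∃ r ∈ T, g = transvection a.2 r}

theorem transvection_mem {T : Set R} {i j : ι} (hij : i ≠ j) {r : R} (hr : r ∈ T) :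
    transvection hij r ∈ transvectionSubgroup ι T :=
  Subgroup.subset_closure ⟨⟨(i, j), hij⟩, r, hr, rfl⟩

theorem transvection_conj_mem_of_ne {T : AddSubgroup R} {i j k l : ι} (hij : i ≠ j) (hkl : k ≠ l)
    (h : ¬ (j = k ∧ i = l)) {c r : R} (hr : r ∈ T) (hcr : c * r ∈ T) :
    transvection hij c * transvection hkl r * (transvection hij c)⁻¹ ∈
      transvectionSubgroup ι (T : Set R) := by
  by_cases hjk : j = k
  · subst hjk
    have hil : i ≠ l := fun h' => h ⟨rfl, h'⟩
    rw [transvection_conj_right hij hkl hil]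
    exact mul_mem (transvection_mem _ hcr) (transvection_mem _ hr)
  · by_cases hil : i = l
    · subst hil
      rw [transvection_conj_left hij hkl (Ne.symm hjk)]
      exact mul_mem (transvection_mem _ (mul_comm c r ▸ neg_mem hcr)) (transvection_mem _ hr)
    · rw [transvection_conj_of_ne hij hkl hjk hil]
      exact transvection_mem _ hr

/-- Only opposite positions (i, j) and (j, i) lack a direct relation. There the second transvection
is a commutator through a third index, with parameters r and s, and conjugation treats each factor
by a direct relation. -/
theorem transvection_conj_mem (hι : ∀ i j : ι, ∃ k, i ≠ k ∧ k ≠ j) {T : AddSubgroup R}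
    {i j k l : ι} (hij : i ≠ j) (hkl : k ≠ l) {c r s : R} (hr : r ∈ T) (hs : s ∈ T)
    (hcr : c * r ∈ T) (hcs : c * s ∈ T) (hrs : r * s ∈ T) (hcrs : c * (r * s) ∈ T) :
    transvection hij c * transvection hkl (r * s) * (transvection hij c)⁻¹ ∈
      transvectionSubgroup ι (T : Set R) := by
  by_cases h : j = k ∧ i = l
  · obtain ⟨rfl, rfl⟩ := h
    obtain ⟨m, him, hmj⟩ := hι i j
    rw [transvection_eq_commutatorElement hkl hmj.symm him.symm, ← MulAut.conj_apply,
      map_commutatorElement, commutatorElement_def]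
    have h1 := transvection_conj_mem_of_ne hij hmj.symm (fun h => him h.2) hr hcr
    have h2 := transvection_conj_mem_of_ne hij him.symm (fun h => hmj h.1.symm) hs hcs
    exact mul_mem (mul_mem (mul_mem h1 h2) (inv_mem h1)) (inv_mem h2)
  · exact transvection_conj_mem_of_ne hij hkl h hrs hcrs

section IsLocalRing

theorem transvection_mul_apply {i j : ι} (hij : i ≠ j) (c : R) (M : SpecialLinearGroup ι R)
    (a b : ι) : (transvection hij c * M) a b = M a b + if a = i then c * M j b else 0 := by
  rw [coe_mul]
  change (Matrix.transvection i j c * (M : Matrix ι ι R)) a b = _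
  split_ifs with h
  · subst h; simp
  · simp [h]

/-- Adding multiples of the `k`-th row to the other rows is an elementary operation. -/
theorem exists_mem_mul_apply (k : ι) (a : ι → R) (s : Finset ι) (hs : k ∉ s) :
    ∃ e ∈ transvectionSubgroup ι (Set.univ : Set R), ∀ (M : SpecialLinearGroup ι R) (i j : ι),
      (e * M) i j = M i j + if i ∈ s then a i * M k j else 0 := by
  induction s using Finset.induction_on with
  | empty => exact ⟨1, one_mem _, by simp⟩
  | insert l s hl ih =>
    rw [Finset.mem_insert, not_or] at hs
    obtain ⟨e, he, h⟩ := ih hs.2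
    refine ⟨transvection (Ne.symm hs.1) (a l) * e, mul_mem (transvection_mem _ trivial) he,
      fun M i j => ?_⟩
    rw [mul_assoc, transvection_mul_apply, h, h]
    by_cases hi : i = l
    · subst hi; simp [hl, hs.2]
    · simp [hi]

variable [IsLocalRing R]

/-- Row k of M⁻¹ vanishes at the indices in K, so if column k of M had only nonunits outside K, its
product with that row, which is 1, would lie in the maximal ideal. -/
theorem exists_isUnit_apply (M : SpecialLinearGroup ι R) (K : Finset ι) {k : ι} (hk : k ∉ K)
    (hM : ∀ j ∈ K, ∀ i, M i j = (1 : Matrix ι ι R) i j) : ∃ i ∉ K, IsUnit (M i k) := by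
  by_contra! H
  have hN (j : ι) : ∑ i, (M⁻¹) k i * M i j = (1 : Matrix ι ι R) k j := by
    rw [← Matrix.mul_apply, ← coe_mul, inv_mul_cancel, coe_one]
  have hN0 : ∀ j ∈ K, (M⁻¹) k j = 0 := by
    intro j hj
    have := hN j
    rw [Finset.sum_congr rfl fun i _ => by rw [hM j hj i]] at this
    simpa [Matrix.one_apply, show k ≠ j from fun h => hk (h ▸ hj)] using this
  have h1 := hN k
  rw [Matrix.one_apply_eq] at h1
  have : (1 : R) ∈ IsLocalRing.maximalIdeal R := by
    rw [← h1]
    refine Ideal.sum_mem _ fun i _ => ?_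
    by_cases hi : i ∈ K
    · rw [hN0 i hi, zero_mul]; exact zero_mem _
    · exact Ideal.mul_mem_left _ _ (H i hi)
  exact (Ideal.ne_top_iff_one _).1 (IsLocalRing.maximalIdeal.isMaximal R).ne_top this

theorem exists_mem_mul_apply_self_eq_one (M : SpecialLinearGroup ι R) (K : Finset ι) {k : ι}
    (hk : k ∉ K) (hM : ∀ j ∈ K, ∀ i, M i j = (1 : Matrix ι ι R) i j) :
    ∃ e ∈ transvectionSubgroup ι (Set.univ : Set R),
      (e * M) k k = 1 ∧ ∀ j ∈ K, ∀ i, (e * M) i j = (1 : Matrix ι ι R) i j := by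
  have key (M : SpecialLinearGroup ι R) (hM : ∀ j ∈ K, ∀ i, M i j = (1 : Matrix ι ι R) i j)
      {i l : ι} (hil : i ≠ l) (hl : l ∉ K) (c : R) :
      ∀ j ∈ K, ∀ a, (transvection hil c * M) a j = (1 : Matrix ι ι R) a j := by
    intro j hj a
    rw [transvection_mul_apply, hM j hj, hM j hj, Matrix.one_apply_ne (ne_of_mem_of_not_mem hj hl).symm]
    simp
  obtain ⟨i, hi, hu⟩ := exists_isUnit_apply M K hk hM
  by_cases hik : k = i
  · subst hik
    obtain ⟨u, hu⟩ := hu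
    by_cases hl : ∃ l ∉ K, l ≠ k
    · obtain ⟨l, hl, hlk⟩ := hl
      -- The unit pivot makes the (l, k) entry 1, and row l then corrects the pivot to 1.
      refine ⟨transvection hlk.symm (1 - M k k) * transvection hlk (↑u⁻¹ * (1 - M l k)),
        mul_mem (transvection_mem _ trivial) (transvection_mem _ trivial), ?_, ?_⟩
      · rw [mul_assoc]
        simp only [transvection_mul_apply, hlk.symm, if_true, if_false, ← hu]
        linear_combination ((1 - (u : R)) * (1 - M l k)) * u.inv_mul
      · rw [mul_assoc]
        exact key _ (key _ hM _ hk _) _ hl _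
    -- No spare row is left: M is the identity outside column k, so its determinant is `M k k`.
    · push Not at hl
      refine ⟨1, one_mem _, ?_, by simpa using hM⟩
      have hM' : (M : Matrix ι ι R) = (1 : Matrix ι ι R).updateCol k fun i => M i k := by
        ext i j
        rw [Matrix.updateCol_apply]
        split_ifs with h
        · rw [h]
        · exact hM j (by by_contra h'; exact h (hl j h')) i
      have := M.2
      rw [hM', ← Matrix.cramer_apply, Matrix.cramer_one] at this
      simpa using this
  · obtain ⟨u, hu⟩ := hu
    refine ⟨transvection hik (↑u⁻¹ * (1 - M k k)), transvection_mem _ trivial, ?_, key M hM _ hi _⟩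
    rw [transvection_mul_apply, if_pos rfl, ← hu]
    linear_combination (1 - M k k) * u.inv_mul

/-- Gaussian elimination by columns. Row operations from row k do not disturb the finished columns,
which are zero in that row. -/
theorem transvectionSubgroup_eq_top_of_isLocalRing :
    transvectionSubgroup ι (Set.univ : Set R) = ⊤ := by
  suffices h : ∀ (K : Finset ι) (M : SpecialLinearGroup ι R),
      ∃ e ∈ transvectionSubgroup ι (Set.univ : Set R),
        ∀ j ∈ K, ∀ i, (e * M) i j = (1 : Matrix ι ι R) i j by
    refine eq_top_iff.2 fun M _ => ?_
    obtain ⟨e, he, h⟩ := h Finset.univ M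
    have : e * M = 1 := SpecialLinearGroup.ext _ _ fun i j => h j (Finset.mem_univ j) i
    rw [eq_inv_of_mul_eq_one_right this]
    exact inv_mem he
  intro K
  induction K using Finset.induction_on with
  | empty => exact fun M => ⟨1, one_mem _, by simp⟩
  | insert k K hk ih =>
    intro M
    obtain ⟨e₁, he₁, h₁⟩ := ih M
    obtain ⟨e₂, he₂, h₂, h₂'⟩ := exists_mem_mul_apply_self_eq_one (e₁ * M) K hk h₁
    obtain ⟨e₃, he₃, h₃⟩ := exists_mem_mul_apply k (fun i => -(e₂ * (e₁ * M)) i k)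
      (Finset.univ.erase k) (by simp)
    refine ⟨e₃ * e₂ * e₁, mul_mem (mul_mem he₃ he₂) he₁, fun j hj i => ?_⟩
    rw [mul_assoc, mul_assoc, h₃]
    rcases Finset.mem_insert.1 hj with rfl | hj
    · by_cases hij : i = j
      · subst hij; simp [h₂]
      · simp [hij, h₂]
    · rw [h₂' j hj, h₂' j hj, Matrix.one_apply_ne (ne_of_mem_of_not_mem hj hk).symm]
      simp

end IsLocalRing

/-- The special linear group with its elementary transvections. -/
noncomputable def elementaryFunctor (ι : Type) [Fintype ι] [DecidableEq ι]
    (hι : ∀ i j : ι, ∃ k, i ≠ k ∧ k ≠ j) : ElementaryFunctor.{u} where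
  obj R _ := Matrix.SpecialLinearGroup ι R
  group R _ := inferInstance
  map f := Matrix.SpecialLinearGroup.map f
  Entry := ι × ι
  finite_entry := inferInstance
  entry g k := g k.1 k.2
  entry_injective := fun H => Matrix.SpecialLinearGroup.ext _ _ fun i j => congrFun H (i, j)
  entry_map f g k := rfl
  Root := {p : ι × ι // p.1 ≠ p.2}
  root a r := transvection a.2 r
  root_add a r s := transvection_add a.2 r s
  map_root f a r := by
    refine Matrix.SpecialLinearGroup.ext _ _ fun i j => ?_
    change f (Matrix.transvection a.1.1 a.1.2 r i j) = Matrix.transvection a.1.1 a.1.2 (f r) i j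
    simp [Matrix.transvection, Matrix.single_apply, Matrix.one_apply, apply_ite f]
  root_conj_mem {R} _ S t d c f ht hd hc hf a b := by
    let T : AddSubgroup R := S.toAddSubgroup.map (AddMonoidHom.mulLeft t)
    have hT {x : R} : x ∈ T ↔ ∃ f ∈ S, t * f = x := Iff.rfl
    -- Both factors of (d ^ 2 * t) * (d ^ 4 * t ^ 2 * f) stay in t • S after multiplication by c.
    have := transvection_conj_mem hι (T := T) b.2 a.2 (c := c) (r := d ^ 2 * t)
      (s := d ^ 4 * t ^ 2 * f)
      (hT.2 ⟨d ^ 2, pow_mem hd _, by ring⟩)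
      (hT.2 ⟨d ^ 4 * t * f, mul_mem (mul_mem (pow_mem hd _) ht) hf, by ring⟩)
      (hT.2 ⟨d * (d * c), mul_mem hd hc, by ring⟩)
      (hT.2 ⟨d ^ 3 * (d * c) * t * f, mul_mem (mul_mem (mul_mem (pow_mem hd _) hc) ht) hf, by ring⟩)
      (hT.2 ⟨d ^ 6 * t ^ 2 * f, mul_mem (mul_mem (pow_mem hd _) (pow_mem ht _)) hf, by ring⟩)
      (hT.2 ⟨d ^ 5 * (d * c) * t ^ 2 * f,
        mul_mem (mul_mem (mul_mem (pow_mem hd _) hc) (pow_mem ht _)) hf, by ring⟩)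
    rw [show d ^ 6 * t ^ 3 * f = d ^ 2 * t * (d ^ 4 * t ^ 2 * f) by ring]
    refine (congrArg (_ ∈ Subgroup.closure ·) (Set.ext fun g => ?_)).mpr this
    constructor
    · rintro ⟨a, f, hf, rfl⟩
      exact ⟨a, _, ⟨f, hf, rfl⟩, rfl⟩
    · rintro ⟨a, _, ⟨f, hf, rfl⟩, rfl⟩
      exact ⟨a, f, hf, rfl⟩
  root_mem_commutator a r := by
    obtain ⟨k, hk, hk'⟩ := hι a.1.1 a.1.2
    rw [← mul_one r, transvection_eq_commutatorElement a.2 hk hk']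
    exact Subgroup.commutator_mem_commutator trivial trivial
  closure_root_of_isLocalRing {R} _ _ := by
    rw [← transvectionSubgroup_eq_top_of_isLocalRing, transvectionSubgroup]
    simp

end Matrix.SpecialLinearGroup

/-! ### The symplectic group: root elements and their relations. -/

namespace Matrix.symplecticGroup

/-- The sign of the standard alternating form on `e i` and its dual basis vector. -/
def sign {l R : Type*} [CommRing R] (i : l ⊕ l) : R := i.elim (fun _ => -1) (fun _ => 1)

theorem sign_mul_self {l R : Type*} [CommRing R] (i : l ⊕ l) : (sign i : R) * sign i = 1 := by
  cases i <;> simp [sign]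

variable {l : Type*} [Fintype l] [DecidableEq l] {R : Type*} [CommRing R]

/-- The standard alternating form. -/
def form (u v : l ⊕ l → R) : R := u ⬝ᵥ (J l R *ᵥ v)

/-- The standard basis vectors. -/
abbrev e (i : l ⊕ l) : l ⊕ l → R := Pi.single i 1

theorem form_add_right (u v v' : l ⊕ l → R) : form u (v + v') = form u v + form u v' := by
  simp [form, mulVec_add]

theorem form_smul_left (r : R) (u v : l ⊕ l → R) : form (r • u) v = r * form u v :=
  smul_dotProduct _ _ _

theorem form_smul_right (r : R) (u v : l ⊕ l → R) : form u (r • v) = r * form u v := by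
  simp [form, mulVec_smul]

theorem form_eq_sum (u v : l ⊕ l → R) :
    form u v = ∑ i, (u (.inr i) * v (.inl i) - u (.inl i) * v (.inr i)) := by
  have h (v : l ⊕ l → R) : J l R *ᵥ v = Sum.elim (fun i => -v (.inr i)) (fun i => v (.inl i)) := by
    rw [J, fromBlocks_mulVec]
    ext i
    cases i <;> simp [neg_mulVec]
  rw [form, h, dotProduct, Fintype.sum_sum_type, Finset.sum_sub_distrib]
  simp
  ring

theorem form_self (u : l ⊕ l → R) : form u u = 0 := by
  rw [form_eq_sum]
  exact Finset.sum_eq_zero fun i _ => by ring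

theorem form_swap (u v : l ⊕ l → R) : form u v = -form v u := by
  rw [form_eq_sum, form_eq_sum, ← Finset.sum_neg_distrib]
  exact Finset.sum_congr rfl fun i _ => by ring

theorem form_e_left (i : l ⊕ l) (v : l ⊕ l → R) : form (e i) v = sign i * v i.swap := by
  rw [form_eq_sum]
  cases i with
  | inl i =>
    simp only [sign, Sum.elim_inl, Sum.swap_inl]
    rw [Finset.sum_eq_single i] <;> simp +contextual [eq_comm]
  | inr i =>
    simp only [sign, Sum.elim_inr, Sum.swap_inr]
    rw [Finset.sum_eq_single i] <;> simp +contextual [eq_comm]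

theorem form_e_e (i j : l ⊕ l) : form (e i) (e j : l ⊕ l → R) = if j = i.swap then sign i else 0 := by
  rw [form_e_left, e, Pi.single_apply, mul_ite, mul_one, mul_zero]
  simp only [eq_comm]

theorem form_e_e_of_ne {i j : l ⊕ l} (h : j ≠ i.swap) : form (e i) (e j : l ⊕ l → R) = 0 := by
  rw [form_e_e, if_neg h]

theorem form_mulVec (g : symplecticGroup l R) (u v : l ⊕ l → R) :
    form ((g : Matrix (l ⊕ l) (l ⊕ l) R) *ᵥ u) ((g : Matrix (l ⊕ l) (l ⊕ l) R) *ᵥ v) =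
      form u v := by
  rw [form, ← vecMul_transpose, ← dotProduct_mulVec, mulVec_mulVec, mulVec_mulVec,
    SymplecticGroup.mem_iff'.1 g.2, form]

/-- The rank one operator `w ↦ form v w • u`. -/
def dyad (u v : l ⊕ l → R) : Matrix (l ⊕ l) (l ⊕ l) R := vecMulVec u (v ᵥ* J l R)

theorem dyad_mulVec (u v w : l ⊕ l → R) : dyad u v *ᵥ w = form v w • u := by
  rw [dyad, vecMulVec_mulVec, ← dotProduct_mulVec, form, op_smul_eq_smul]

theorem dyad_mul_dyad (a b c d : l ⊕ l → R) : dyad a b * dyad c d = form b c • dyad a d := by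
  rw [dyad, dyad, vecMulVec_mul_vecMulVec, ← dotProduct_mulVec, form, dyad]
  ext
  simp [vecMulVec_apply]
  ring

theorem dyad_add_left (u u' v : l ⊕ l → R) : dyad (u + u') v = dyad u v + dyad u' v :=
  add_vecMulVec _ _ _

theorem dyad_add_right (u v v' : l ⊕ l → R) : dyad u (v + v') = dyad u v + dyad u v' := by
  rw [dyad, add_vecMul, vecMulVec_add, dyad, dyad]

theorem dyad_smul_left (r : R) (u v : l ⊕ l → R) : dyad (r • u) v = r • dyad u v :=
  smul_vecMulVec _ _ _

theorem dyad_smul_right (r : R) (u v : l ⊕ l → R) : dyad u (r • v) = r • dyad u v := by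
  rw [dyad, smul_vecMul, vecMulVec_smul, dyad]

theorem J_mul_dyad (u v : l ⊕ l → R) : J l R * dyad u v = -(dyad v u)ᵀ * J l R := by
  ext i j
  simp only [dyad, mul_vecMulVec, Matrix.neg_mul, transpose_vecMulVec, vecMulVec_mul]
  rw [Matrix.neg_apply, vecMulVec_apply, vecMulVec_apply, ← neg_mul]
  congr 1
  rw [← mulVec_transpose, J_transpose, neg_mulVec, Pi.neg_apply, neg_neg]

theorem dyad_mul (g : symplecticGroup l R) (u v : l ⊕ l → R) :
    dyad ((g : Matrix (l ⊕ l) (l ⊕ l) R) *ᵥ u) ((g : Matrix (l ⊕ l) (l ⊕ l) R) *ᵥ v) *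
      (g : Matrix (l ⊕ l) (l ⊕ l) R) = (g : Matrix (l ⊕ l) (l ⊕ l) R) * dyad u v := by
  rw [dyad, dyad, vecMulVec_mul, mul_vecMulVec, ← vecMul_transpose (g : Matrix (l ⊕ l) (l ⊕ l) R) v,
    vecMul_vecMul, vecMul_vecMul, ← Matrix.mul_assoc, SymplecticGroup.mem_iff'.1 g.2]

/-- The terms of (1 + Nᵀ)J(1 + N) linear in N cancel, and NᵀJN = -JN² = 0. -/
theorem one_add_mem {N : Matrix (l ⊕ l) (l ⊕ l) R} (h : J l R * N = -Nᵀ * J l R)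
    (hN : N * N = 0) : 1 + N ∈ symplecticGroup l R := by
  rw [SymplecticGroup.mem_iff', Matrix.transpose_add, Matrix.transpose_one, Matrix.add_mul,
    Matrix.one_mul, show Nᵀ * J l R = -(J l R * N) by rw [h]; simp, Matrix.mul_add, Matrix.mul_one,
    Matrix.add_mul, Matrix.neg_mul, Matrix.mul_assoc, hN]
  simp

/-- The symplectic transvection `w ↦ w + r • form u w • u`. -/
def long (u : l ⊕ l → R) (r : R) : symplecticGroup l R :=
  ⟨1 + r • dyad u u, one_add_mem (by simp [J_mul_dyad]) (by simp [dyad_mul_dyad, form_self])⟩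

/-- The symplectic map `w ↦ w + r • (form v w • u + form u w • v)` for orthogonal `u`, `v`. -/
def short (u v : l ⊕ l → R) (h : form u v = 0) (r : R) : symplecticGroup l R :=
  ⟨1 + r • (dyad u v + dyad v u), one_add_mem
    (by simp [J_mul_dyad, Matrix.mul_add, Matrix.add_mul, add_comm])
    (by
      have h' : form v u = 0 := by rw [form_swap, h, neg_zero]
      simp [Matrix.mul_add, Matrix.add_mul, dyad_mul_dyad, form_self, h, h'])⟩

theorem coe_long (u : l ⊕ l → R) (r : R) :
    (long u r : Matrix (l ⊕ l) (l ⊕ l) R) = 1 + r • dyad u u := rfl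

theorem coe_short (u v : l ⊕ l → R) (h : form u v = 0) (r : R) :
    (short u v h r : Matrix (l ⊕ l) (l ⊕ l) R) = 1 + r • (dyad u v + dyad v u) := rfl

theorem long_mulVec (u : l ⊕ l → R) (r : R) (w : l ⊕ l → R) :
    (long u r : Matrix (l ⊕ l) (l ⊕ l) R) *ᵥ w = w + (r * form u w) • u := by
  rw [coe_long, add_mulVec, one_mulVec, smul_mulVec, dyad_mulVec, smul_smul]

theorem short_mulVec (u v : l ⊕ l → R) (h : form u v = 0) (r : R) (w : l ⊕ l → R) :
    (short u v h r : Matrix (l ⊕ l) (l ⊕ l) R) *ᵥ w =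
      w + (r * form v w) • u + (r * form u w) • v := by
  rw [coe_short, add_mulVec, one_mulVec, smul_mulVec, add_mulVec, dyad_mulVec, dyad_mulVec, smul_add,
    smul_smul, smul_smul, add_assoc]

theorem long_add (u : l ⊕ l → R) (r s : R) : long u (r + s) = long u r * long u s := by
  apply Subtype.ext
  simp only [Submonoid.coe_mul, coe_long, Matrix.mul_add, Matrix.add_mul, smul_mul_smul_comm,
    dyad_mul_dyad, form_self, add_smul, zero_smul, smul_zero, Matrix.one_mul, Matrix.mul_one]
  abel

theorem short_add (u v : l ⊕ l → R) (h : form u v = 0) (r s : R) :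
    short u v h (r + s) = short u v h r * short u v h s := by
  apply Subtype.ext
  have h' : form v u = 0 := by rw [form_swap, h, neg_zero]
  simp only [Submonoid.coe_mul, coe_short, Matrix.mul_add, Matrix.add_mul, smul_mul_smul_comm,
    dyad_mul_dyad, form_self, h, h', add_smul, zero_smul, smul_zero, Matrix.one_mul, Matrix.mul_one,
    add_zero]
  abel

theorem short_comm (u v : l ⊕ l → R) (h : form u v = 0) (r : R) :
    short u v h r = short v u (by rw [form_swap, h, neg_zero]) r := by
  apply Subtype.ext
  rw [coe_short, coe_short, add_comm (dyad u v)]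

theorem short_smul_right (u v : l ⊕ l → R) (h : form u v = 0) (r s : R) :
    short u (s • v) (by rw [form_smul_right, h, mul_zero]) r = short u v h (r * s) := by
  apply Subtype.ext
  rw [coe_short, coe_short, dyad_smul_left, dyad_smul_right, ← smul_add, smul_smul]

theorem long_smul (u : l ⊕ l → R) (r s : R) : long (s • u) r = long u (s ^ 2 * r) := by
  apply Subtype.ext
  rw [coe_long, coe_long, dyad_smul_left, dyad_smul_right, smul_smul, smul_smul]
  ring_nf

theorem short_zero_right (u : l ⊕ l → R) (h : form u 0 = 0) (r : R) : short u 0 h r = 1 := by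
  apply Subtype.ext
  rw [coe_short]
  simp [dyad]

/-- Expansion of a short element in one of its orthogonal arguments. -/
theorem short_add_right (u v v' : l ⊕ l → R) (h : form u v = 0) (h' : form u v' = 0) (r : R) :
    short u (v + v') (by rw [form_add_right, h, h', add_zero]) r =
      short u v h r * short u v' h' r * long u (-(r ^ 2 * form v v')) := by
  have k : form v u = 0 := by rw [form_swap, h, neg_zero]
  have k' : form v' u = 0 := by rw [form_swap, h', neg_zero]
  apply Subtype.ext
  simp only [Submonoid.coe_mul, coe_short, coe_long, Matrix.mul_add, Matrix.add_mul,
    Matrix.smul_mul, Matrix.mul_smul, dyad_mul_dyad, form_self, h', k, k', zero_smul, smul_zero,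
    Matrix.one_mul, Matrix.mul_one, add_zero, dyad_add_left, dyad_add_right, smul_add]
  module

theorem long_add_left (u v : l ⊕ l → R) (h : form u v = 0) (r : R) :
    long (u + v) r = long u r * long v r * short u v h r := by
  have k : form v u = 0 := by rw [form_swap, h, neg_zero]
  apply Subtype.ext
  simp only [Submonoid.coe_mul, coe_short, coe_long, Matrix.mul_add, Matrix.add_mul,
    smul_mul_smul_comm, dyad_mul_dyad, form_self, h, k, zero_smul, smul_zero,
    Matrix.one_mul, Matrix.mul_one, add_zero, dyad_add_left, dyad_add_right, smul_add]
  module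

/-- As g preserves the form, conjugation only moves the vectors. Commutator relations thus reduce to
expanding root elements of sums of vectors. -/
theorem conj_long (g : symplecticGroup l R) (u : l ⊕ l → R) (r : R) :
    g * long u r * g⁻¹ = long ((g : Matrix (l ⊕ l) (l ⊕ l) R) *ᵥ u) r := by
  rw [mul_inv_eq_iff_eq_mul]
  apply Subtype.ext
  rw [Submonoid.coe_mul, Submonoid.coe_mul, coe_long, coe_long, Matrix.add_mul, Matrix.smul_mul,
    dyad_mul, Matrix.mul_add, Matrix.mul_smul, Matrix.one_mul, Matrix.mul_one]

theorem conj_short (g : symplecticGroup l R) (u v : l ⊕ l → R) (h : form u v = 0) (r : R) :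
    g * short u v h r * g⁻¹ = short ((g : Matrix (l ⊕ l) (l ⊕ l) R) *ᵥ u)
      ((g : Matrix (l ⊕ l) (l ⊕ l) R) *ᵥ v) (by rw [form_mulVec, h]) r := by
  rw [mul_inv_eq_iff_eq_mul]
  apply Subtype.ext
  rw [Submonoid.coe_mul, Submonoid.coe_mul, coe_short, coe_short, Matrix.add_mul, Matrix.smul_mul,
    Matrix.add_mul, dyad_mul, dyad_mul, Matrix.mul_add, Matrix.mul_smul, Matrix.one_mul,
    Matrix.mul_one, Matrix.mul_add]

end Matrix.symplecticGroup

namespace Matrix.symplecticGroup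

theorem sign_mul_mem {l R : Type*} [CommRing R] {T : AddSubgroup R} (i : l ⊕ l) {r : R} (hr : r ∈ T) : sign i * r ∈ T := by
  cases i <;> simpa [sign] using hr

variable {l : Type*} [Fintype l] [DecidableEq l] {R : Type*} [CommRing R]

theorem long_zero (u : l ⊕ l → R) : long u 0 = 1 := by
  apply Subtype.ext
  simp [coe_long]

theorem short_congr {u u' v v' : l ⊕ l → R} (hu : u = u') (hv : v = v') (h : form u v = 0) (r : R) :
    short u v h r = short u' v' (by rw [← hu, ← hv, h]) r := by
  subst hu hv; rfl

theorem short_self (u : l ⊕ l → R) (h : form u u = 0) (r : R) : short u u h r = long u (r + r) := by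
  apply Subtype.ext
  rw [coe_short, coe_long, smul_add, add_smul]

/-- The first factor fixes y and adds a multiple of u to x; expanding the conjugated second factor
leaves just the extra short element. -/
theorem commutatorElement_short_short {u v x y : l ⊕ l → R} (huv : form u v = 0) (hxy : form x y = 0)
    (hux : form u x = 0) (huy : form u y = 0) (hvy : form v y = 0) (p s : R) :
    ⁅short u v huv p, short x y hxy s⁆ = short u y huy (s * (p * form v x)) := by
  have hyx : form y x = 0 := by rw [form_swap, hxy, neg_zero]
  have hyu : form y u = 0 := by rw [form_swap, huy, neg_zero]
  have hyu' : form y ((p * form v x) • u) = 0 := by rw [form_smul_right, hyu, mul_zero]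
  have hx : (short u v huv p : Matrix (l ⊕ l) (l ⊕ l) R) *ᵥ x = (p * form v x) • u + x := by
    rw [short_mulVec, hux]; module
  have hy : (short u v huv p : Matrix (l ⊕ l) (l ⊕ l) R) *ᵥ y = y := by
    rw [short_mulVec, huy, hvy]; module
  rw [commutatorElement_def, conj_short, short_congr hx hy, short_comm, short_add_right _ _ _ hyu' hyx,
    form_smul_left, hux, mul_zero, mul_zero, neg_zero, long_zero, mul_one, short_smul_right _ _ hyu,
    short_comm x, mul_inv_cancel_right, short_comm]

/-- Conjugation replaces x by x plus a multiple of u; the long element of this sum contains a long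
element along u, for which one solves. -/
theorem long_eq_conj {u v x : l ⊕ l → R} (huv : form u v = 0) (hux : form u x = 0) (p s : R) :
    long u ((p * form v x) ^ 2 * s) = short u v huv p * long x s * (short u v huv p)⁻¹ *
      (short u x hux (s * (p * form v x)))⁻¹ * (long x s)⁻¹ := by
  have hxu : form x u = 0 := by rw [form_swap, hux, neg_zero]
  have hux' : form ((p * form v x) • u) x = 0 := by rw [form_smul_left, hux, mul_zero]
  have hx : (short u v huv p : Matrix (l ⊕ l) (l ⊕ l) R) *ᵥ x = (p * form v x) • u + x := by
    rw [short_mulVec, hux]; module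
  have hcomm : Commute (long x s) (short u x hux (s * (p * form v x))) := by
    apply Subtype.ext
    simp only [Submonoid.coe_mul, coe_long, coe_short, Matrix.mul_add, Matrix.add_mul,
      Matrix.smul_mul, Matrix.mul_smul, dyad_mul_dyad, form_self, hux, hxu, zero_smul, smul_zero,
      Matrix.one_mul, Matrix.mul_one, add_zero]
    abel
  rw [conj_long, hx, long_add_left _ _ hux', long_smul, short_comm _ x, short_smul_right _ _ hxu,
    short_comm x, mul_inv_cancel_right, mul_inv_cancel_right]

/-- The roots of the symplectic group. -/
abbrev RootIndex (l : Type*) : Type _ :=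
  (l ⊕ l) ⊕ {p : (l ⊕ l) × (l ⊕ l) // p.1 ≠ p.2 ∧ p.2 ≠ p.1.swap}

/-- The root elements of the symplectic group. -/
def root (a : RootIndex l) (r : R) : symplecticGroup l R :=
  match a with
  | .inl i => long (e i) r
  | .inr p => short (e p.1.1) (e p.1.2) (form_e_e_of_ne p.2.2) r

variable (l) in
/-- The subgroup generated by the root elements with coefficient in `T`. -/
def rootSubgroup (T : Set R) : Subgroup (symplecticGroup l R) :=
  Subgroup.closure {g | ∃ a : RootIndex l, ∃ r ∈ T, g = root a r}

theorem long_mem {T : Set R} (i : l ⊕ l) {r : R} (hr : r ∈ T) : long (e i) r ∈ rootSubgroup l T :=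
  Subgroup.subset_closure ⟨.inl i, r, hr, rfl⟩

theorem ne_swap_of_form_eq_zero [Nontrivial R] {i j : l ⊕ l}
    (h : form (e i) (e j : l ⊕ l → R) = 0) : j ≠ i.swap := by
  rintro rfl
  rw [form_e_e, if_pos rfl] at h
  have := sign_mul_self (R := R) i
  rw [h, mul_zero] at this
  exact zero_ne_one this

theorem short_mem {T : AddSubgroup R} {i j : l ⊕ l} (h : form (e i) (e j : l ⊕ l → R) = 0) {r : R}
    (hr : r ∈ T) : short (e i) (e j) h r ∈ rootSubgroup l (T : Set R) := by
  nontriviality R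
  by_cases hij : i = j
  · subst hij
    rw [short_self]
    exact long_mem _ (add_mem hr hr)
  · exact Subgroup.subset_closure ⟨.inr ⟨(i, j), hij, ne_swap_of_form_eq_zero h⟩, r, hr, rfl⟩

/-- Short elements with one basis vector expand into root elements. -/
theorem short_e_mem {T : AddSubgroup R} (i : l ⊕ l) (w : l ⊕ l → R) (h : form (e i) w = 0) (r : R)
    (h1 : ∀ a, r * w a ∈ T) (h2 : ∀ a b, r ^ 2 * (w a * w b) ∈ T) :
    short (e i) w h r ∈ rootSubgroup l (T : Set R) := by
  have key (s : Finset (l ⊕ l)) (hs : i.swap ∉ s) : ∃ h : form (e i) (∑ a ∈ s, w a • e a) = 0,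
      short (e i) (∑ a ∈ s, w a • e a) h r ∈ rootSubgroup l (T : Set R) := by
    induction s using Finset.induction_on with
    | empty =>
      refine ⟨by simp [form], ?_⟩
      rw [short_congr rfl Finset.sum_empty, short_zero_right]
      exact one_mem _
    | insert a s ha ih =>
      rw [Finset.mem_insert, not_or] at hs
      obtain ⟨h0, ih⟩ := ih hs.2
      have ha0 : form (e i) (e a : l ⊕ l → R) = 0 := form_e_e_of_ne (Ne.symm hs.1)
      have ha' : form (e i) (w a • (e a : l ⊕ l → R)) = 0 := by rw [form_smul_right, ha0, mul_zero]
      have hsum := Finset.sum_insert (f := fun a => w a • (e a : l ⊕ l → R)) ha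
      refine ⟨by rw [hsum, form_add_right, ha', h0, add_zero], ?_⟩
      rw [short_congr rfl hsum, short_add_right _ _ _ ha' h0, short_smul_right _ _ ha0]
      -- The correction pairs `e a` with the rest of the sum, so only the product of the coordinates
      -- at a and `a.swap` enters.
      refine mul_mem (mul_mem (short_mem _ (h1 a)) ih) (long_mem _ (neg_mem ?_))
      rw [form_smul_left, form_e_left, Finset.sum_apply]
      have : ∑ c ∈ s, (w c • (e c : l ⊕ l → R)) a.swap = if a.swap ∈ s then w a.swap else 0 := by
        simp [Pi.single_apply]
      rw [this]
      split_ifs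
      · convert sign_mul_mem a (h2 a a.swap) using 1
        ring
      · simp [zero_mem]
  -- Orthogonality to `e i` removes the one basis vector that does not pair to zero with it.
  have hw : w i.swap = 0 := by
    rw [form_e_left] at h
    rw [← one_mul (w i.swap), ← sign_mul_self i, mul_assoc, h, mul_zero]
  have hw' : w = ∑ a ∈ Finset.univ.erase i.swap, w a • e a := by
    rw [Finset.sum_erase _ (by rw [hw, zero_smul])]
    exact pi_eq_sum_univ' w
  obtain ⟨h', hmem⟩ := key (Finset.univ.erase i.swap) (by simp)
  rwa [short_congr rfl hw']

theorem root_mulVec_e_of_ne {b : RootIndex l} {c : R} {i : l ⊕ l}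
    (h : match b with | .inl k => i ≠ k.swap | .inr p => i ≠ p.1.1.swap ∧ i ≠ p.1.2.swap) :
    (root b c : Matrix (l ⊕ l) (l ⊕ l) R) *ᵥ e i = e i := by
  match b, h with
  | .inl k, h =>
    rw [root, long_mulVec, form_e_e_of_ne h]; simp
  | .inr p, h =>
    rw [root, short_mulVec, form_e_e_of_ne h.1, form_e_e_of_ne h.2]; simp

theorem dyad_e_mem (S : Subring R) (i j a b : l ⊕ l) : dyad (e i) (e j : l ⊕ l → R) a b ∈ S := by
  have : dyad (e i) (e j : l ⊕ l → R) a b = form (e j) (e b : l ⊕ l → R) * e i a := by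
    have := congrFun (dyad_mulVec (e i) (e j : l ⊕ l → R) (e b)) a
    rwa [e, mulVec_single_one] at this
  rw [this, form_e_e, e, Pi.single_apply]
  refine mul_mem ?_ (by split_ifs <;> simp [one_mem, zero_mem])
  split_ifs
  · cases j <;> simp [sign, one_mem]
  · exact zero_mem _

theorem mul_root_apply_mem (S : Subring R) {d c : R} (hd : d ∈ S) (hc : d * c ∈ S)
    (b : RootIndex l) (i j : l ⊕ l) :
    d * (root b c : Matrix (l ⊕ l) (l ⊕ l) R) i j ∈ S := by
  have key {N : Matrix (l ⊕ l) (l ⊕ l) R} (hN : N i j ∈ S) :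
      d * (1 + c • N : Matrix (l ⊕ l) (l ⊕ l) R) i j ∈ S := by
    rw [Matrix.add_apply, Matrix.smul_apply, smul_eq_mul, mul_add, ← mul_assoc]
    refine add_mem (mul_mem hd ?_) (mul_mem hc hN)
    rw [Matrix.one_apply]
    split_ifs <;> simp [one_mem, zero_mem]
  match b with
  | .inl k => exact key (dyad_e_mem S k k i j)
  | .inr p => exact key (add_mem (dyad_e_mem S _ _ i j) (dyad_e_mem S _ _ i j))

/-! ### Conjugating symplectic root elements with denominators. -/

section Conj

variable (S : Subring R) {t d : R} (ht : t ∈ S) (hd : d ∈ S)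

/-- The additive group `t • S`. -/
abbrev multiples (t : R) : AddSubgroup R := S.toAddSubgroup.map (AddMonoidHom.mulLeft t)

theorem mem_multiples {t f x : R} (hf : f ∈ S) (h : x = t * f) : x ∈ multiples S t := ⟨f, hf, h.symm⟩

include ht hd in
-- With `e j` fixed, the conjugate is still short with one basis vector, so it expands along the
-- coordinates of g(e i), whose denominators d clears.
theorem conj_short_mem {g : symplecticGroup l R}
    (hg : ∀ i j, d * (g : Matrix (l ⊕ l) (l ⊕ l) R) i j ∈ S) {i j : l ⊕ l}
    (hgj : (g : Matrix (l ⊕ l) (l ⊕ l) R) *ᵥ e j = e j)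
    (h : form (e i) (e j : l ⊕ l → R) = 0) {f : R} (hf : f ∈ S) :
    g * short (e i) (e j) h (d ^ 2 * t * f) * g⁻¹ ∈ rootSubgroup l (multiples S t : Set R) := by
  rw [conj_short, short_comm, short_congr hgj rfl]
  apply short_e_mem
  · intro a
    rw [mulVec_single_one]
    refine mem_multiples S (mul_mem (mul_mem hd hf) (hg a i)) ?_
    rw [Matrix.col_apply]
    ring
  · intro a b
    rw [mulVec_single_one]
    refine mem_multiples S (mul_mem (mul_mem (mul_mem ht (pow_mem (mul_mem hd hf) 2))
      (hg a i)) (hg b i)) ?_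
    rw [Matrix.col_apply, Matrix.col_apply]
    ring

include ht hd in
-- A hyperbolic pair fixed by g writes the element as a commutator of two short elements, each
-- involving a fixed vector.
theorem conj_short_mem_of_third {g : symplecticGroup l R}
    (hg : ∀ i j, d * (g : Matrix (l ⊕ l) (l ⊕ l) R) i j ∈ S) {i j q : l ⊕ l}
    (hgq : (g : Matrix (l ⊕ l) (l ⊕ l) R) *ᵥ e q = e q)
    (hgq' : (g : Matrix (l ⊕ l) (l ⊕ l) R) *ᵥ e q.swap = e q.swap)
    (hiq : form (e i) (e q : l ⊕ l → R) = 0) (hiq' : form (e i) (e q.swap : l ⊕ l → R) = 0)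
    (hqj : form (e q) (e j : l ⊕ l → R) = 0) (hqj' : form (e q.swap) (e j : l ⊕ l → R) = 0)
    (h : form (e i) (e j : l ⊕ l → R) = 0) {f : R} (hf : f ∈ S) :
    g * short (e i) (e j) h (d ^ 6 * t ^ 3 * f) * g⁻¹ ∈
      rootSubgroup l (multiples S t : Set R) := by
  have hs : (sign q : R) ∈ S := by cases q <;> simp [sign, one_mem]
  have heq := commutatorElement_short_short hiq hqj' hiq' h hqj (d ^ 2 * t * 1)
    (d ^ 2 * t * (d ^ 2 * t * f * sign q))
  rw [form_e_e, if_pos rfl, show d ^ 2 * t * (d ^ 2 * t * f * sign q) * (d ^ 2 * t * 1 * sign q) =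
    d ^ 6 * t ^ 3 * f * (sign q * sign q) by ring, sign_mul_self, mul_one (d ^ 6 * t ^ 3 * f)] at heq
  rw [← heq, ← MulAut.conj_apply, map_commutatorElement, commutatorElement_def]
  have h1 := conj_short_mem S ht hd hg hgq hiq (one_mem S)
  have h2 := conj_short_mem S ht hd hg hgq' (i := j) (by rw [form_swap, hqj', neg_zero])
    (mul_mem (mul_mem (mul_mem (pow_mem hd 2) ht) hf) hs)
  rw [short_comm] at h2
  exact mul_mem (mul_mem (mul_mem h1 h2) (inv_mem h1)) (inv_mem h2)

include ht hd in
-- `long_eq_conj` with a fixed hyperbolic pair gives the parameter p ^ 2 * s up to a squared sign; p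
-- = d ^ 2 * t and s = d ^ 2 * t * f account for the exponents 6 and 3.
theorem conj_long_mem_of_other {g : symplecticGroup l R}
    (hg : ∀ i j, d * (g : Matrix (l ⊕ l) (l ⊕ l) R) i j ∈ S) {i q : l ⊕ l}
    (hgq : (g : Matrix (l ⊕ l) (l ⊕ l) R) *ᵥ e q = e q)
    (hgq' : (g : Matrix (l ⊕ l) (l ⊕ l) R) *ᵥ e q.swap = e q.swap)
    (hiq : form (e i) (e q : l ⊕ l → R) = 0) (hiq' : form (e i) (e q.swap : l ⊕ l → R) = 0)
    {f : R} (hf : f ∈ S) :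
    g * long (e i) (d ^ 6 * t ^ 3 * f) * g⁻¹ ∈ rootSubgroup l (multiples S t : Set R) := by
  have hs : (sign q : R) ∈ S := by cases q <;> simp [sign, one_mem]
  have heq := long_eq_conj hiq hiq' (d ^ 2 * t * 1) (d ^ 2 * t * f)
  rw [form_e_e, if_pos rfl, show (d ^ 2 * t * 1 * sign q) ^ 2 * (d ^ 2 * t * f) =
    d ^ 6 * t ^ 3 * f * (sign q * sign q) by ring, sign_mul_self, mul_one (d ^ 6 * t ^ 3 * f),
    show d ^ 2 * t * f * (d ^ 2 * t * 1 * sign q) = d ^ 2 * t * (d ^ 2 * t * f * sign q) by ring]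
    at heq
  rw [heq, ← MulAut.conj_apply]
  simp only [map_mul, map_inv, MulAut.conj_apply]
  have h1 := conj_short_mem S ht hd hg hgq hiq (one_mem S)
  have h2 := conj_short_mem S ht hd hg hgq' hiq' (mul_mem (mul_mem (mul_mem (pow_mem hd 2) ht) hf) hs)
  have h3 : g * long (e q.swap) (d ^ 2 * t * f) * g⁻¹ ∈
      rootSubgroup l (multiples S t : Set R) := by
    rw [conj_long, hgq']
    apply long_mem
    exact mem_multiples S (mul_mem (pow_mem hd 2) hf) (by ring)
  exact mul_mem (mul_mem (mul_mem (mul_mem h1 h3) (inv_mem h1)) (inv_mem h2)) (inv_mem h3)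

include hd in
theorem conj_long_mem_of_mulVec {g : symplecticGroup l R} {i k : l ⊕ l} {y : R} (hy : d * y ∈ S)
    (hg : (g : Matrix (l ⊕ l) (l ⊕ l) R) *ᵥ e i = e i + y • e k)
    (hik : form (e i) (e k : l ⊕ l → R) = 0) {f : R} (hf : f ∈ S) :
    g * long (e i) (d ^ 2 * t * f) * g⁻¹ ∈ rootSubgroup l (multiples S t : Set R) := by
  rw [conj_long, hg, long_add_left _ _ (by rw [form_smul_right, hik, mul_zero]), long_smul,
    short_smul_right _ _ hik]
  refine mul_mem (mul_mem (long_mem _ ?_) (long_mem _ ?_)) (short_mem _ ?_)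
  · exact mem_multiples S (mul_mem (pow_mem hd 2) hf) (by ring)
  · exact mem_multiples S (mul_mem (pow_mem hy 2) hf) (by ring)
  · exact mem_multiples S (mul_mem (mul_mem hd hy) hf) (by ring)

end Conj

end Matrix.symplecticGroup

namespace Matrix.symplecticGroup

theorem elim_swap {l : Type*} (j : l ⊕ l) : j.swap.elim id id = j.elim id id := by cases j <;> rfl

theorem swap_ne {l : Type*} {i j : l ⊕ l} {K : Finset l} (hi : i.elim id id ∉ K) (hj : j.elim id id ∈ K) :
    j ≠ i.swap := by
  rintro rfl
  exact hi (elim_swap i ▸ hj)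

variable {l : Type*} [Fintype l] [DecidableEq l] {R : Type*} [CommRing R]

theorem form_inl_e_of_ne {i : l ⊕ l} {z : l} (h : z ≠ i.elim id id) :
    form (e i) (e (.inl z) : l ⊕ l → R) = 0 ∧ form (e i) (e (.inr z) : l ⊕ l → R) = 0 ∧
      form (e (.inl z)) (e i : l ⊕ l → R) = 0 ∧ form (e (.inr z)) (e i : l ⊕ l → R) = 0 := by
  cases i <;> refine ⟨form_e_e_of_ne ?_, form_e_e_of_ne ?_, form_e_e_of_ne ?_, form_e_e_of_ne ?_⟩ <;>
    simp_all [eq_comm]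

/-- Long by long: some hyperbolic plane avoids both. Long by short: `e i` moves by a multiple of one
basis vector. For a short element, either one of its vectors is fixed, or the support of b is used
up by the two and a third plane is fixed. -/
theorem root_conj_mem (hl : ∀ i j : l, ∃ k, k ≠ i ∧ k ≠ j) (S : Subring R) {t d c f : R}
    (ht : t ∈ S) (hd : d ∈ S) (hc : d * c ∈ S) (hf : f ∈ S) (a b : RootIndex l) :
    root b c * root a (d ^ 6 * t ^ 3 * f) * (root b c)⁻¹ ∈
      rootSubgroup l (multiples S t : Set R) := by
  have hg := mul_root_apply_mem S hd hc b
  have hf' : d ^ 4 * t ^ 2 * f ∈ S := mul_mem (mul_mem (pow_mem hd 4) (pow_mem ht 2)) hf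
  have hdt : d ^ 6 * t ^ 3 * f = d ^ 2 * t * (d ^ 4 * t ^ 2 * f) := by ring
  match a with
  | .inl i =>
    change root b c * long (e i) _ * (root b c)⁻¹ ∈ _
    match b, hg with
    | .inl k, hg =>
      obtain ⟨z, hz, hz'⟩ := hl (i.elim id id) (k.elim id id)
      obtain ⟨h1, h2, -, -⟩ := form_inl_e_of_ne (R := R) hz
      refine conj_long_mem_of_other S ht hd hg (q := .inl z) ?_ ?_ h1 h2 hf
      · apply root_mulVec_e_of_ne; cases k <;> simp_all
      · apply root_mulVec_e_of_ne; cases k <;> simp_all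
    | .inr ⟨(k, k'), hne, hsw⟩, hg =>
      have hmul (v : l ⊕ l → R) := short_mulVec (e k) (e k') (form_e_e_of_ne hsw) c v
      rw [hdt]
      have hform (k : l ⊕ l) : d * (c * form (e k) (e i : l ⊕ l → R)) ∈ S := by
        rw [← mul_assoc]
        refine mul_mem hc ?_
        rw [form_e_e]
        split_ifs
        · cases k <;> simp [sign, one_mem]
        · exact zero_mem _
      by_cases h1 : i = k.swap
      · refine conj_long_mem_of_mulVec S hd (hform k) (k := k') ?_ ?_ hf'
        · change (short (e k) (e k') (form_e_e_of_ne hsw) c : Matrix (l ⊕ l) (l ⊕ l) R) *ᵥ e i = _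
          rw [hmul, form_e_e_of_ne (i := k') (j := i)]
          · simp
          · rintro rfl
            exact hne (Sum.swap_leftInverse.injective h1).symm
        · apply form_e_e_of_ne
          rw [h1, Sum.swap_swap]
          exact hne.symm
      · refine conj_long_mem_of_mulVec S hd (hform k') (k := k) ?_ ?_ hf'
        · change (short (e k) (e k') (form_e_e_of_ne hsw) c : Matrix (l ⊕ l) (l ⊕ l) R) *ᵥ e i = _
          rw [hmul, form_e_e_of_ne (i := k) (j := i) h1]
          simp
        · apply form_e_e_of_ne
          rintro rfl
          exact h1 (Sum.swap_swap i).symm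
  | .inr ⟨(i, j), hij, hij'⟩ =>
    change root b c * short (e i) (e j) (form_e_e_of_ne hij') _ * (root b c)⁻¹ ∈ _
    by_cases hgj : (root b c : Matrix (l ⊕ l) (l ⊕ l) R) *ᵥ e j = e j
    · rw [hdt]
      exact conj_short_mem S ht hd hg hgj _ hf'
    by_cases hgi : (root b c : Matrix (l ⊕ l) (l ⊕ l) R) *ᵥ e i = e i
    · rw [hdt, short_comm]
      exact conj_short_mem S ht hd hg hgi _ hf'
    obtain ⟨z, hz, hz'⟩ := hl (i.elim id id) (j.elim id id)
    obtain ⟨h1, h2, -, -⟩ := form_inl_e_of_ne (R := R) hz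
    obtain ⟨-, -, h3, h4⟩ := form_inl_e_of_ne (R := R) hz'
    have hfix : ∀ q : l ⊕ l, q.elim id id = z →
        (root b c : Matrix (l ⊕ l) (l ⊕ l) R) *ᵥ e q = e q := by
      intro q hq
      apply root_mulVec_e_of_ne
      match b with
      | .inl k =>
        have hi : i = k.swap := by
          by_contra h; exact hgi (root_mulVec_e_of_ne (b := .inl k) h)
        have hj : j = k.swap := by
          by_contra h; exact hgj (root_mulVec_e_of_ne (b := .inl k) h)
        exact absurd (hi.trans hj.symm) hij
      | .inr ⟨(k, k'), hne, hsw⟩ =>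
        have hi : i = k.swap ∨ i = k'.swap := by
          by_contra! h; exact hgi (root_mulVec_e_of_ne (b := .inr ⟨(k, k'), hne, hsw⟩) h)
        have hj : j = k.swap ∨ j = k'.swap := by
          by_contra! h; exact hgj (root_mulVec_e_of_ne (b := .inr ⟨(k, k'), hne, hsw⟩) h)
        have hqi : q ≠ i := by rintro rfl; exact hz hq.symm
        have hqj : q ≠ j := by rintro rfl; exact hz' hq.symm
        rcases hi with hi | hi <;> rcases hj with hj | hj
        · exact absurd (hi.trans hj.symm) hij
        · exact ⟨hi ▸ hqi, hj ▸ hqj⟩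
        · exact ⟨hj ▸ hqj, hi ▸ hqi⟩
        · exact absurd (hi.trans hj.symm) hij
    exact conj_short_mem_of_third S ht hd hg (q := .inl z) (hfix _ rfl) (hfix _ rfl) h1 h2 h3 h4 _ hf

/-- A third plane makes short elements commutators; `long_eq_conj` makes a long one a commutator
times a conjugate of a short one. -/
theorem root_mem_commutator (hl : ∀ i j : l, ∃ k, k ≠ i ∧ k ≠ j) (a : RootIndex l) (r : R) :
    root a r ∈ commutator (symplecticGroup l R) := by
  have short_mem (i j : l ⊕ l) (h : form (e i) (e j) = 0) (r : R) :
      short (e i) (e j) h r ∈ commutator (symplecticGroup l R) := by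
    obtain ⟨z, hz, hz'⟩ := hl (i.elim id id) (j.elim id id)
    obtain ⟨h1, h2, -, -⟩ := form_inl_e_of_ne (R := R) hz
    obtain ⟨-, -, h3, h4⟩ := form_inl_e_of_ne (R := R) hz'
    have := commutatorElement_short_short h1 h4 h2 h h3 1 (r * sign (.inl z))
    rw [form_e_e, if_pos (by rfl), one_mul, mul_assoc, sign_mul_self, mul_one] at this
    rw [← this]
    exact Subgroup.commutator_mem_commutator trivial trivial
  match a with
  | .inl i =>
    obtain ⟨z, hz, -⟩ := hl (i.elim id id) (i.elim id id)
    obtain ⟨h1, h2, -, -⟩ := form_inl_e_of_ne (R := R) hz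
    have := long_eq_conj h1 h2 1 r
    rw [form_e_e, if_pos (by rfl), one_mul, pow_two, sign_mul_self, one_mul] at this
    change long (e i) r ∈ _
    rw [this]
    have hc := Subgroup.commutator_mem_commutator (H₁ := ⊤) (H₂ := ⊤) (Subgroup.mem_top
      (short (e i) (e (.inl z)) h1 1)) (Subgroup.mem_top (long (e (.inr z)) r))
    have hn := (inferInstance : (commutator (symplecticGroup l R)).Normal).conj_mem _
      (inv_mem (short_mem _ _ h2 (r * sign (.inl z)))) (long (e (.inr z)) r)
    convert mul_mem (commutator_def (symplecticGroup l R) ▸ hc) hn using 1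
    rw [commutatorElement_def]
    group
  | .inr p => exact short_mem _ _ (form_e_e_of_ne p.2.2) r

/-! ### Symplectic generation over local rings. -/

section IsLocalRing

/-- Basis vectors indexed by `K` are fixed by `g`. -/
def Fixes (K : Finset l) (g : symplecticGroup l R) : Prop :=
  ∀ j : l ⊕ l, j.elim id id ∈ K → (g : Matrix (l ⊕ l) (l ⊕ l) R) *ᵥ e j = e j

theorem Fixes.mul {K : Finset l} {g h : symplecticGroup l R} (hg : Fixes K g) (hh : Fixes K h) :
    Fixes K (g * h) := fun j hj => by
  rw [Submonoid.coe_mul, ← mulVec_mulVec, hh j hj, hg j hj]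

theorem fixes_long {K : Finset l} {i : l ⊕ l} (hi : i.elim id id ∉ K) (r : R) :
    Fixes K (long (e i) r) := fun j hj => by
  rw [long_mulVec, form_e_e_of_ne (swap_ne hi hj)]
  simp

theorem fixes_short {K : Finset l} {i : l ⊕ l} (hi : i.elim id id ∉ K) {w : l ⊕ l → R}
    (hw : ∀ j : l ⊕ l, j.elim id id ∈ K → w j = 0) (h : form (e i) w = 0) (r : R) :
    Fixes K (short (e i) w h r) := fun j hj => by
  rw [short_mulVec, form_e_e_of_ne (swap_ne hi hj), form_swap w, form_e_left,
    hw _ ((elim_swap j).symm ▸ hj)]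
  simp

/-- Since g fixes `e j.swap` and preserves its orthogonality to `e p`, the image of `e p` has no
coordinate at j. -/
theorem Fixes.apply_eq_zero {K : Finset l} {g : symplecticGroup l R} (hg : Fixes K g) {p : l ⊕ l}
    (hp : p.elim id id ∉ K) {j : l ⊕ l} (hj : j.elim id id ∈ K) :
    ((g : Matrix (l ⊕ l) (l ⊕ l) R) *ᵥ e p) j = 0 := by
  have hj' : j.swap.elim id id ∈ K := (elim_swap j).symm ▸ hj
  have := form_mulVec g (e j.swap) (e p)
  rw [hg _ hj', form_swap (e j.swap) (e p), form_e_e_of_ne (swap_ne hp hj'), form_e_left,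
    Sum.swap_swap, neg_zero] at this
  have hs := congrArg (sign j.swap * ·) this
  rwa [← mul_assoc, sign_mul_self, one_mul, mul_zero] at hs

variable (l R) in
/-- The elementary symplectic group. -/
abbrev elementary : Subgroup (symplecticGroup l R) := rootSubgroup l ((⊤ : AddSubgroup R) : Set R)

/-- A vector with a coordinate equal to one can be moved to the corresponding basis vector. -/
theorem exists_mulVec_eq_e {K : Finset l} {p : l ⊕ l} (hp : p.elim id id ∉ K) {v : l ⊕ l → R}
    (hv : ∀ j : l ⊕ l, j.elim id id ∈ K → v j = 0) (hvp : v p = 1) :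
    ∃ g ∈ elementary l R, Fixes K g ∧
      (g : Matrix (l ⊕ l) (l ⊕ l) R) *ᵥ e p.swap = e p.swap ∧
      (g : Matrix (l ⊕ l) (l ⊕ l) R) *ᵥ v = e p := by
  have hps : p ≠ p.swap := by cases p <;> simp
  have hp' : p.swap.elim id id ∉ K := (elim_swap p).symm ▸ hp
  let a : l ⊕ l → R := v - e p - v p.swap • e p.swap
  have hva : v = e p + v p.swap • e p.swap + a := by simp only [a]; abel
  have ha : form (e p.swap) a = 0 := by
    rw [form_e_left, Sum.swap_swap]
    simp [a, hvp, hps]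
  have haK (j : l ⊕ l) (hj : j.elim id id ∈ K) : a j = 0 := by
    have h1 : j ≠ p := by rintro rfl; exact hp hj
    have h2 : j ≠ p.swap := by rintro rfl; exact hp' hj
    simp [a, hv j hj, h1, h2]
  have hfv : form (e p.swap) v = sign p.swap := by rw [form_e_left, Sum.swap_swap, hvp, mul_one]
  -- g₁ removes the part a of v outside the hyperbolic plane, altering only the coordinate at
  -- `p.swap` to y; g₂ then clears y.
  let g₁ := short (e p.swap) a ha (-sign p.swap)
  let y := v p.swap + -sign p.swap * form a v
  let g₂ := long (e p.swap) (-(y * sign p.swap))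
  have hee : form (e p.swap) (e p : l ⊕ l → R) = sign p.swap := by
    rw [form_e_e, if_pos (by simp)]
  refine ⟨g₂ * g₁, mul_mem (long_mem _ trivial)
    (short_e_mem _ _ _ _ (fun _ => trivial) fun _ _ => trivial),
    (fixes_long hp' _).mul (fixes_short hp' haK ha _), ?_, ?_⟩
  · rw [Submonoid.coe_mul, ← mulVec_mulVec, short_mulVec, form_self, form_swap a, ha]
    simp only [neg_zero, mul_zero, zero_smul, add_zero]
    rw [long_mulVec, form_self]
    simp
  · have h1 : (g₁ : Matrix (l ⊕ l) (l ⊕ l) R) *ᵥ v = e p + y • e p.swap := by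
      rw [short_mulVec, hfv, neg_mul (sign _) (sign _), sign_mul_self]
      conv_lhs => rw [add_assoc]; arg 1; rw [hva]
      module
    rw [Submonoid.coe_mul, ← mulVec_mulVec, h1, long_mulVec, form_add_right, form_smul_right,
      form_self, hee, mul_zero, add_zero, neg_mul, mul_assoc, sign_mul_self]
    module

/-- A unit coordinate can be used to make another coordinate equal to one. -/
theorem exists_mulVec_apply_eq_one {K : Finset l} {p i : l ⊕ l} (hp : p.elim id id ∉ K)
    (hi : i.elim id id ∉ K) (hip : i ≠ p) {v : l ⊕ l → R} (hv : IsUnit (v i)) :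
    ∃ g ∈ elementary l R, Fixes K g ∧ ((g : Matrix (l ⊕ l) (l ⊕ l) R) *ᵥ v) p = 1 := by
  obtain ⟨u, hu⟩ := hv
  by_cases h : i = p.swap
  · refine ⟨long (e p) ((1 - v p) * ↑u⁻¹ * sign p), long_mem _ trivial, fixes_long hp _, ?_⟩
    rw [long_mulVec, form_e_left, ← h, ← hu]
    simp only [Pi.add_apply, Pi.smul_apply, Pi.single_eq_same, smul_eq_mul, mul_one]
    linear_combination (1 - v p) * (↑u⁻¹ * u) * sign_mul_self (R := R) p + (1 - v p) * u.inv_mul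
  · have hne : i.swap ≠ p.swap := fun h' => hip (Sum.swap_leftInverse.injective h')
    have hf : form (e p) (e i.swap : l ⊕ l → R) = 0 := form_e_e_of_ne hne
    have hne' : p ≠ i.swap := by rintro rfl; exact h (Sum.swap_swap i).symm
    refine ⟨short (e p) (e i.swap) hf ((1 - v p) * ↑u⁻¹ * sign i.swap),
      short_mem _ trivial, fixes_short hp (fun j hj => ?_) hf _, ?_⟩
    · rw [e, Pi.single_apply, if_neg (swap_ne hi hj)]
    · rw [short_mulVec, form_e_left i.swap, Sum.swap_swap, ← hu]
      simp only [Pi.add_apply, Pi.smul_apply, Pi.single_eq_same, smul_eq_mul, mul_one,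
        Pi.single_apply, if_neg hne', mul_zero, add_zero]
      linear_combination (1 - v p) * (↑u⁻¹ * u) * sign_mul_self (R := R) i.swap +
        (1 - v p) * u.inv_mul

variable [IsLocalRing R]

/-- Otherwise all coordinates of g(e p) would be nonunits, and so would its pairing with g(e
p.swap), which is ±1. -/
theorem Fixes.exists_isUnit {K : Finset l} {g : symplecticGroup l R} (hg : Fixes K g) {p : l ⊕ l}
    (hp : p.elim id id ∉ K) : ∃ i : l ⊕ l, i.elim id id ∉ K ∧
      IsUnit (((g : Matrix (l ⊕ l) (l ⊕ l) R) *ᵥ e p) i) := by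
  by_contra! H
  have hmem (i : l ⊕ l) : ((g : Matrix (l ⊕ l) (l ⊕ l) R) *ᵥ e p) i ∈ IsLocalRing.maximalIdeal R := by
    by_cases hi : i.elim id id ∈ K
    · rw [hg.apply_eq_zero hp hi]; exact zero_mem _
    · exact H i hi
  have h1 := form_mulVec g (e p.swap) (e p)
  rw [form_e_e, if_pos (by simp), form_eq_sum] at h1
  have h2 : (sign p.swap : R) ∈ IsLocalRing.maximalIdeal R := by
    rw [← h1]
    exact Ideal.sum_mem _ fun i _ => sub_mem (Ideal.mul_mem_left _ _ (hmem _))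
      (Ideal.mul_mem_left _ _ (hmem _))
  have h3 := Ideal.mul_mem_left _ (sign p.swap) h2
  rw [sign_mul_self] at h3
  exact (Ideal.ne_top_iff_one _).1 (IsLocalRing.maximalIdeal.isMaximal R).ne_top h3

/-- One hyperbolic pair is restored at a time. Once `e p` is fixed, invariance of the form gives the
image of `e p.swap` the coordinate 1 at `p.swap`, and the correction of that vector fixes `e p`. -/
theorem elementary_eq_top_of_isLocalRing : elementary l R = ⊤ := by
  suffices h : ∀ (K : Finset l) (M : symplecticGroup l R), ∃ g ∈ elementary l R, Fixes K (g * M) by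
    refine eq_top_iff.2 fun M _ => ?_
    obtain ⟨g, hg, h⟩ := h Finset.univ M
    have : g * M = 1 := by
      apply Subtype.ext
      ext i j
      have := congrFun (h j (Finset.mem_univ _)) i
      rw [mulVec_single_one] at this
      simpa [Pi.single_apply, Matrix.one_apply] using this
    rw [eq_inv_of_mul_eq_one_right this]
    exact inv_mem hg
  intro K
  induction K using Finset.induction_on with
  | empty => exact fun M => ⟨1, one_mem _, fun j hj => absurd hj (Finset.notMem_empty _)⟩
  | insert k K hk ih =>
    intro M
    obtain ⟨g₁, hg₁, hM₁⟩ := ih M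
    let p : l ⊕ l := .inl k
    have hp : p.elim id id ∉ K := hk
    have hp' : p.swap.elim id id ∉ K := hk
    obtain ⟨i, hi, hu⟩ := hM₁.exists_isUnit hp
    have hone : ∃ g ∈ elementary l R, Fixes K g ∧ ((g : Matrix (l ⊕ l) (l ⊕ l) R) *ᵥ
        (((g₁ * M : symplecticGroup l R) : Matrix (l ⊕ l) (l ⊕ l) R) *ᵥ e p)) p = 1 := by
      -- A unit can normalize only a different coordinate, so a unit at p itself is used through
      -- `p.swap`.
      by_cases hip : i = p
      · subst hip
        obtain ⟨g, hg, hgK, h1⟩ := exists_mulVec_apply_eq_one hp' hi (by simp [p]) hu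
        obtain ⟨g', hg', hgK', h2⟩ := exists_mulVec_apply_eq_one (p := p) hp hp' (by simp [p])
          (h1 ▸ isUnit_one)
        refine ⟨g' * g, mul_mem hg' hg, hgK'.mul hgK, ?_⟩
        rw [Submonoid.coe_mul, ← mulVec_mulVec, h2]
      · exact exists_mulVec_apply_eq_one hp hi hip hu
    obtain ⟨g₂, hg₂, hgK₂, h₂⟩ := hone
    rw [mulVec_mulVec, ← Submonoid.coe_mul] at h₂
    have hM₂ := hgK₂.mul hM₁
    obtain ⟨g₃, hg₃, hgK₃, -, h₃⟩ := exists_mulVec_eq_e hp (fun j hj => hM₂.apply_eq_zero hp hj) h₂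
    rw [mulVec_mulVec, ← Submonoid.coe_mul] at h₃
    have hM₃ := hgK₃.mul hM₂
    have h₃' : (((g₃ * (g₂ * (g₁ * M)) : symplecticGroup l R) : Matrix (l ⊕ l) (l ⊕ l) R) *ᵥ
        e p.swap) p.swap = 1 := by
      have := form_mulVec (g₃ * (g₂ * (g₁ * M))) (e p) (e p.swap)
      rw [h₃, form_e_e, if_pos rfl, form_e_left] at this
      have hs := congrArg (sign p * ·) this
      rwa [← mul_assoc, sign_mul_self, one_mul] at hs
    obtain ⟨g₄, hg₄, hgK₄, h₄, h₄'⟩ :=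
      exists_mulVec_eq_e hp' (fun j hj => hM₃.apply_eq_zero hp' hj) h₃'
    refine ⟨g₄ * g₃ * g₂ * g₁, mul_mem (mul_mem (mul_mem hg₄ hg₃) hg₂) hg₁, fun j hj => ?_⟩
    rw [mul_assoc, mul_assoc, mul_assoc]
    rcases Finset.mem_insert.1 hj with hj | hj
    · rw [Submonoid.coe_mul, ← mulVec_mulVec]
      cases j with
      | inl j =>
        obtain rfl : j = k := hj
        rw [h₃]
        exact h₄
      | inr j =>
        obtain rfl : j = k := hj
        exact h₄'
    · exact hgK₄.mul hM₃ j hj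

end IsLocalRing

/-- The symplectic group with its root elements. -/
noncomputable def elementaryFunctor (m : ℕ)
    (hm : ∀ i j : Fin m, ∃ k, k ≠ i ∧ k ≠ j) : ElementaryFunctor.{u} where
  obj R _ := Matrix.symplecticGroup (Fin m) R
  group R _ := inferInstance
  map f := GradedLG.symplecticMap m f
  Entry := (Fin m ⊕ Fin m) × (Fin m ⊕ Fin m)
  finite_entry := inferInstance
  entry g k := (g : Matrix _ _ _) k.1 k.2
  entry_injective := fun H => Subtype.ext (Matrix.ext fun i j => congrFun H (i, j))
  entry_map f g k := rfl
  Root := RootIndex (Fin m)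
  root a r := root a r
  root_add a r s := by
    match a with
    | .inl i => exact long_add _ r s
    | .inr p => exact short_add _ _ (form_e_e_of_ne p.2.2) r s
  map_root {R S} _ _ f a r := by
    apply Subtype.ext
    have hd (i j : Fin m ⊕ Fin m) :
        (dyad (e i) (e j : Fin m ⊕ Fin m → R)).map f = dyad (e i) (e j) := by
      rw [dyad, dyad]
      ext a b
      rw [Matrix.map_apply, Matrix.vecMulVec_apply, Matrix.vecMulVec_apply, map_mul]
      congr 1
      · simp [Pi.single_apply, apply_ite f]
      · rw [single_one_vecMul, single_one_vecMul, ← Matrix.map_J _ f]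
        rfl
    have h1 (N : Matrix (Fin m ⊕ Fin m) (Fin m ⊕ Fin m) R) :
        (1 + r • N).map f = 1 + f r • N.map f := by
      ext a b
      simp [Matrix.one_apply, apply_ite f]
    match a with
    | .inl i =>
      change (1 + r • dyad (e i) (e i) : Matrix _ _ R).map f =
        (1 + f r • dyad (e i) (e i) : Matrix _ _ S)
      rw [h1, hd]
    | .inr p =>
      change (1 + r • (dyad (e p.1.1) (e p.1.2) + dyad (e p.1.2) (e p.1.1)) : Matrix _ _ R).map f =
        (1 + f r • (dyad (e p.1.1) (e p.1.2) + dyad (e p.1.2) (e p.1.1)) : Matrix _ _ S)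
      rw [h1, Matrix.map_add _ (map_add f), hd, hd]
  root_conj_mem {R} _ S t d c f ht hd hc hf a b := by
    refine (congrArg (_ ∈ Subgroup.closure ·) (Set.ext fun g => ?_)).mpr
      (root_conj_mem hm S ht hd hc hf a b)
    constructor
    · rintro ⟨a, f, hf, rfl⟩
      exact ⟨a, _, ⟨f, hf, rfl⟩, rfl⟩
    · rintro ⟨a, _, ⟨f, hf, rfl⟩, rfl⟩
      exact ⟨a, f, hf, rfl⟩
  root_mem_commutator a r := root_mem_commutator hm a r
  closure_root_of_isLocalRing {R} _ _ := by
    rw [← elementary_eq_top_of_isLocalRing, elementary, rootSubgroup]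
    simp

end Matrix.symplecticGroup

/-! ### Both groups over a graded ring. -/

theorem theorem4p8 {A : Type*} [CommRing A] [IsNoetherianRing A]
    (𝒜 : ℕ → AddSubgroup A) [GradedRing 𝒜] :
    (∀ n : ℕ, 3 ≤ n → ∀ α : Matrix.SpecialLinearGroup (Fin n) A,
      Matrix.SpecialLinearGroup.map (GradedLG.plus 𝒜 0) α = 1 →
      (∀ p : PrimeSpectrum (𝒜 0),
        Matrix.SpecialLinearGroup.map (algebraMap A (GradedLG.LocAt 𝒜 p)) α ∈
          commutator (Matrix.SpecialLinearGroup (Fin n) (GradedLG.LocAt 𝒜 p))) →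
      α ∈ commutator (Matrix.SpecialLinearGroup (Fin n) A)) ∧
    (∀ m : ℕ, 3 ≤ m → ∀ α : Matrix.symplecticGroup (Fin m) A,
      GradedLG.symplecticMap m (GradedLG.plus 𝒜 0) α = 1 →
      (∀ p : PrimeSpectrum (𝒜 0),
        GradedLG.symplecticMap m (algebraMap A (GradedLG.LocAt 𝒜 p)) α ∈
          commutator (Matrix.symplecticGroup (Fin m) (GradedLG.LocAt 𝒜 p))) →
      α ∈ commutator (Matrix.symplecticGroup (Fin m) A)) := by
  have hthird (n : ℕ) (hn : 3 ≤ n) (i j : Fin n) : ∃ k, k ≠ i ∧ k ≠ j := by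
    have : ∃ k, k ∉ ({i, j} : Finset (Fin n)) := by
      by_contra! h
      have h1 := Finset.card_le_card (fun k _ => h k : Finset.univ ⊆ ({i, j} : Finset (Fin n)))
      have h2 := Finset.card_le_two (a := i) (b := j)
      rw [Finset.card_univ, Fintype.card_fin] at h1
      omega
    simpa using this
  refine ⟨fun n hn α h0 hα => ?_, fun m hm α h0 hα => ?_⟩
  · exact (Matrix.SpecialLinearGroup.elementaryFunctor (Fin n) fun i j =>
      (hthird n hn i j).imp fun k hk => ⟨hk.1.symm, hk.2⟩).mem_commutator_of_forall_localizationAt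
        𝒜 α h0 hα
  · exact (Matrix.symplecticGroup.elementaryFunctor m (hthird m hm)).mem_commutator_of_forall_localizationAt
      𝒜 α h0 hα
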